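/- Let $M$ be a smooth (finite-dimensional, Hausdorff) manifold. Write $A^k(M)=\Gamma(\wedge^kTM)$ for the smooth $k$-vector fields ($A^0(M)=C^\infty(M)$, $A^k(M)=0$ for $k<0$), $\mathcal A(M)=\bigoplus_k A^k(M)$, $\Omega^m(M)$ for the $m$-forms, and $[\cdot,\cdot]$ for the Schouten–Nijenhuis bracket: the $\mathbb R$-bilinear extension of the Lie bracket of vector fields such that $[f,g]=0$ and $[X,Q]=L_XQ$ for functions $f,g$, vector fields $X$ and $Q\in\mathcal A(M)$, $[P,Q]=-(-1)^{(p-1)(q-1)}[Q,P]$, and $[P,\cdot]$ is a derivation of degree $p-1$ of the exterior product, for $P\in A^p(M)$, $Q\in A^q(M)$. For $X\in A^k(M)$ and a form $\omega$ let $i_X\omega=\omega(X\wedge\,\cdot\,)$ (with $i_f\omega=f\omega$ for functions $f$, and $i_X\omega=0$ if $\deg\omega<k$) and $L_X\omega=d\,i_X\omega-(-1)^k i_X\,d\omega$. A higher connection on $M$ is a map $\nabla:\mathcal A(M)\times\mathcal A(M)\to\mathcal A(M)$, additive in both arguments, with $\nabla_XY\in A^{k+l-1}(M)$ for $X\in A^k(M)$,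 $Y\in A^l(M)$; $\nabla_{fX}Y=f\nabla_XY$; $\nabla_Xf=[X,f]$; $\nabla_X(fY)=[X,f]\wedge Y+f\nabla_XY$; $\nabla_fX=0$ (for $f\in C^\infty(M)$). It is induced if, for all $X\in A^k(M)$, $Y\in A^l(M)$, $Z\in\mathcal A(M)$, $$\nabla_{X\wedge Y}Z=X\wedge\nabla_YZ+(-1)^{kl}\,Y\wedge\nabla_XZ,\qquad \nabla_X(Y\wedge Z)=(\nabla_XY)\wedge Z+(-1)^{(k-1)l}\,Y\wedge\nabla_XZ,$$ and torsion-free if $\nabla_XY-(-1)^{(k-1)(l-1)}\nabla_YX-[X,Y]=0$ for all $X\in A^k(M)$, $Y\in A^l(M)$. For $\omega\in\Omega^m(M)$ and $X\in A^k(M)$ with $k>0$ and $m-k+1\ge0$, the covariant derivative $\nabla_X\omega$ is the form of degree $m-k+1$ with $$(\nabla_X\omega)(Y)=(-1)^{(k-1)(m-1)}L_X\,i_Y\omega-\omega(\nabla_XY)\qquad\text{for all }Y\in A^{m-k+1}(M),$$ where $\eta(f)=f\eta$ for functions $\eta,f$; and $\nabla_X\omega=0$ if $k=0$ or $m-k+1<0$.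 Theorem. Let $\nabla$ be a torsion-free induced higher connection on $M$. Then the covariant derivatives $\nabla_X\omega$ are well defined by these conditions, and $$\nabla_{X\wedge Y}\,\omega=(-1)^l\,i_Y\nabla_X\omega+(-1)^{k(l-1)}\,i_X\nabla_Y\omega$$ for all $k,l,m\ge0$, $X\in A^k(M)$, $Y\in A^l(M)$ and $\omega\in\Omega^m(M)$. -/

import Mathlib

open scoped Manifold ContDiff

noncomputable section

namespace HigherConn

/-! ## Multivectors and forms on the model space -/

/-- The model space `ℝⁿ`. -/
abbrev Model (n : ℕ) : Type := EuclideanSpace ℝ (Fin n)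

/-- The basis `e_S = e_{i₁} ∧ ⋯ ∧ e_{i_k}`, `S = {i₁ < ⋯ < i_k}`, of the exterior algebra of `ℝⁿ`. -/
def extBasis (n : ℕ) : Module.Basis (Finset (Fin n)) ℝ (ExteriorAlgebra ℝ (Model n)) :=
  (EuclideanSpace.basisFun (Fin n) ℝ).toBasis.ExteriorAlgebra

/-- The partial derivative `∂_i g` at `y` of a function with values in the exterior algebra of
`ℝⁿ`, computed component by component in the basis `e_S`. -/
def partialDeriv {n : ℕ} (i : Fin n) (g : Model n → ExteriorAlgebra ℝ (Model n)) (y : Model n) :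
    ExteriorAlgebra ℝ (Model n) :=
  ∑ S : Finset (Fin n),
    (fderiv ℝ (fun z => (extBasis n).repr (g z) S) y (EuclideanSpace.single i 1)) • extBasis n S

/-- The contraction `dx^i ⌋ v` of a multivector: the antiderivation with
`dx^i ⌋ (v₁ ∧ ⋯ ∧ v_k) = ∑ⱼ (-1)^(j-1) dx^i(vⱼ) v₁ ∧ ⋯ ∧ v̂ⱼ ∧ ⋯ ∧ v_k`. -/
def contractDx {n : ℕ} (i : Fin n) :
    ExteriorAlgebra ℝ (Model n) →ₗ[ℝ] ExteriorAlgebra ℝ (Model n) :=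
  CliffordAlgebra.contractLeft
    (EuclideanSpace.proj i : Model n →L[ℝ] ℝ).toLinearMap

/-- The Schouten–Nijenhuis bracket in coordinates. For `p` of degree `k` this is
`[p, q] = (-1)^(k-1) ∑ᵢ (dx^i ⌋ p) ∧ ∂_i q - ∑ᵢ ∂_i p ∧ (dx^i ⌋ q)`
(`involute` multiplies a multivector of degree `k - 1` by `(-1)^(k-1)`). -/
def schoutenCoord {n : ℕ} (p q : Model n → ExteriorAlgebra ℝ (Model n)) (y : Model n) :
    ExteriorAlgebra ℝ (Model n) :=
  ∑ i : Fin n, (CliffordAlgebra.involute (contractDx i (p y)) * partialDeriv i q y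
    - partialDeriv i p y * contractDx i (q y))

theorem continuous_alternatingMap {n j : ℕ} (f : Model n [⋀^Fin j]→ₗ[ℝ] ℝ) : Continuous f := by
  have h : ∀ v : Fin j → Model n,
      f v = ∑ r : Fin j → Fin n, (∏ i, v i (r i)) •
        f (fun i => (EuclideanSpace.basisFun (Fin n) ℝ).toBasis (r i)) := by
    intro v
    have hv : v = fun i => ∑ s, v i s • (EuclideanSpace.basisFun (Fin n) ℝ).toBasis s := by
      funext i
      conv_lhs => rw [← (EuclideanSpace.basisFun (Fin n) ℝ).toBasis.sum_repr (v i)]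
      simp
    conv_lhs => rw [hv]
    have h1 := f.toMultilinearMap.map_sum
      (fun i s => v i s • (EuclideanSpace.basisFun (Fin n) ℝ).toBasis s)
    have h2 : ∀ r : Fin j → Fin n, f (fun i => v i (r i) •
        (EuclideanSpace.basisFun (Fin n) ℝ).toBasis (r i)) = (∏ i, v i (r i)) •
        f (fun i => (EuclideanSpace.basisFun (Fin n) ℝ).toBasis (r i)) :=
      fun r => f.toMultilinearMap.map_smul_univ _ _
    simp only [← h2]
    exact h1
  have h' : (f : (Fin j → Model n) → ℝ) = _ := funext h
  rw [h']
  fun_prop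

/-- An alternating form on `ℝⁿ`, as a continuous one. -/
def toContinuousAlternating {n j : ℕ} (f : Model n [⋀^Fin j]→ₗ[ℝ] ℝ) :
    Model n [⋀^Fin j]→L[ℝ] ℝ :=
  { f with cont := continuous_alternatingMap f }

/-- The exterior derivative on `ℝⁿ`. A differential form is given as a function with values in the
linear functionals on the exterior algebra; its component of degree `j` is the alternating form
`(v₁, …, vⱼ) ↦ w(v₁ ∧ ⋯ ∧ vⱼ)`. -/
def extDerivCoord {n : ℕ} (w : Model n → Module.Dual ℝ (ExteriorAlgebra ℝ (Model n)))
    (y : Model n) : Module.Dual ℝ (ExteriorAlgebra ℝ (Model n)) :=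
  ExteriorAlgebra.liftAlternating (R := ℝ) fun j =>
    match j with
    | 0 => 0
    | j + 1 => (extDeriv (fun z => toContinuousAlternating
        ((w z).compAlternatingMap (ExteriorAlgebra.ιMulti ℝ j))) y).toAlternatingMap

/-! ## Multivector fields and differential forms on a manifold -/

section Manifold

variable {n : ℕ} {M : Type*} [TopologicalSpace M] [ChartedSpace (Model n) M]
  [IsManifold (𝓡 n) ∞ M]

variable (n M) in
/-- Arbitrary sections of the full exterior bundle `⋀ TM`. -/
abbrev MVSection : Type _ := (x : M) → ExteriorAlgebra ℝ (TangentSpace (𝓡 n) x)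

variable (n M) in
/-- Arbitrary sections of the dual bundle `(⋀ TM)* = ⨁ₘ (⋀ᵐ TM)*`. A linear functional on `⋀ᵐ V` is
the same as an alternating `m`-linear form on `V`, so an `m`-form on `M` is a section vanishing
on `⋀ʲ TM` for `j ≠ m`. -/
abbrev FormSection : Type _ :=
  (x : M) → Module.Dual ℝ (ExteriorAlgebra ℝ (TangentSpace (𝓡 n) x))

/-- For `p` in the domain of the chart at `x`: the map `⋀ T_pM → ⋀ ℝⁿ` induced by the derivative at
`p` of the chart at `x`. -/
def toChart (x p : M) :
    ExteriorAlgebra ℝ (TangentSpace (𝓡 n) p) →ₐ[ℝ] ExteriorAlgebra ℝ (Model n) :=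
  ExteriorAlgebra.map
    ((trivializationAt (Model n) (TangentSpace (𝓡 n)) x).continuousLinearMapAt ℝ p).toLinearMap

/-- For `p` in the domain of the chart at `x`: the inverse `⋀ ℝⁿ → ⋀ T_pM` of `toChart x p`. -/
def fromChart (x p : M) :
    ExteriorAlgebra ℝ (Model n) →ₐ[ℝ] ExteriorAlgebra ℝ (TangentSpace (𝓡 n) p) :=
  ExteriorAlgebra.map
    ((trivializationAt (Model n) (TangentSpace (𝓡 n)) x).symmL ℝ p).toLinearMap

/-- A section of `⋀ TM` is smooth if its components in the charts are. -/
def IsSmoothMV (X : MVSection n M) : Prop :=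
  ∀ (x : M) (S : Finset (Fin n)),
    ContMDiffAt (𝓡 n) 𝓘(ℝ, ℝ) ∞ (fun p => (extBasis n).repr (toChart x p (X p)) S) x

/-- A section of `(⋀ TM)*` is smooth if its components in the charts are. -/
def IsSmoothForm (w : FormSection n M) : Prop :=
  ∀ (x : M) (S : Finset (Fin n)),
    ContMDiffAt (𝓡 n) 𝓘(ℝ, ℝ) ∞ (fun p => w p (fromChart x p (extBasis n S))) x

variable (n M) in
/-- The algebra `𝒜(M)` of multivector fields: smooth sections of `⋀ TM`, with the pointwise exterior
product as multiplication. -/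
def MVField : Subalgebra ℝ (MVSection n M) where
  carrier := {X | IsSmoothMV X}
  mul_mem' := by
    intro X Y hX hY x S
    have h : (fun p => (extBasis n).repr (toChart x p ((X * Y) p)) S) = fun p =>
        ∑ A, ∑ B, (extBasis n).repr (toChart x p (X p)) A *
          ((extBasis n).repr (toChart x p (Y p)) B *
            (extBasis n).repr (extBasis n A * extBasis n B) S) := by
      funext p
      rw [Pi.mul_apply, map_mul]
      conv_lhs => rw [← (extBasis n).sum_repr (toChart x p (X p)),
        ← (extBasis n).sum_repr (toChart x p (Y p))]
      simp only [Finset.sum_mul_sum, map_sum, Finsupp.coe_finsetSum, Finset.sum_apply,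
        smul_mul_smul_comm, map_smul, Finsupp.smul_apply, smul_eq_mul, mul_assoc]
    rw [h]
    exact contMDiffAt_finsetSum fun A _ => contMDiffAt_finsetSum fun B _ =>
      (hX x A).mul ((hY x B).mul contMDiffAt_const)
  add_mem' := by
    intro X Y hX hY x S
    have h := (hX x S).add (hY x S)
    refine h.congr_of_eventuallyEq (Filter.Eventually.of_forall fun p => ?_)
    simp
  algebraMap_mem' := by
    intro r x S
    simpa using contMDiffAt_const

/-- `A^k(M)`: the multivector fields of degree `k`, i.e. the sections of `⋀ᵏ TM`. -/
def IsDegree (k : ℕ) (X : MVField n M) : Prop :=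
  ∀ x : M, X.1 x ∈ ⋀[ℝ]^k (TangentSpace (𝓡 n) x)

/-- Smooth functions, as multivector fields of degree `0`. -/
def ofFun (f : C^∞⟮𝓡 n, M; 𝓘(ℝ, ℝ), ℝ⟯) : MVField n M :=
  ⟨fun x => algebraMap ℝ _ (f x), by
    intro x S
    have h : (fun p => (extBasis n).repr (toChart x p
        (algebraMap ℝ (ExteriorAlgebra ℝ (TangentSpace (𝓡 n) p)) (f p))) S) =
        fun p => f p * (extBasis n).repr 1 S := by
      funext p
      rw [AlgHom.commutes, Algebra.algebraMap_eq_smul_one, map_smul, Finsupp.smul_apply,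
        smul_eq_mul]
    rw [h]
    exact f.contMDiff.contMDiffAt.mul contMDiffAt_const⟩

/-- `w` is a differential `m`-form: a smooth section of `(⋀ᵐ TM)*`. -/
structure IsForm (m : ℕ) (w : FormSection n M) : Prop where
  smooth : IsSmoothForm w
  degree : ∀ (x : M) (j : ℕ), j ≠ m → ∀ v ∈ ⋀[ℝ]^j (TangentSpace (𝓡 n) x), w x v = 0

/-- The Schouten–Nijenhuis bracket, computed at `x` in the chart at `x`. -/
def schouten (X Y : MVSection n M) : MVSection n M := fun x =>
  fromChart x x (schoutenCoord
    (fun y => toChart x ((extChartAt (𝓡 n) x).symm y) (X ((extChartAt (𝓡 n) x).symm y)))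
    (fun y => toChart x ((extChartAt (𝓡 n) x).symm y) (Y ((extChartAt (𝓡 n) x).symm y)))
    (extChartAt (𝓡 n) x x))

/-- The exterior derivative, computed at `x` in the chart at `x`. -/
def extD (w : FormSection n M) : FormSection n M := fun x =>
  extDerivCoord
    (fun y => (w ((extChartAt (𝓡 n) x).symm y)) ∘ₗ
      (fromChart x ((extChartAt (𝓡 n) x).symm y)).toLinearMap)
    (extChartAt (𝓡 n) x x) ∘ₗ (toChart x x).toLinearMap

/-- The interior product `(i_X w)(Z) = w(X ∧ Z)`. For `X` of degree `k` and an `m`-form `w` this is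
the function `w(X)` if `k = m` and `0` if `k > m`; for a function `f` it is `f w`. -/
def interiorProd (X : MVSection n M) (w : FormSection n M) : FormSection n M := fun x =>
  w x ∘ₗ LinearMap.mulLeft ℝ (X x)

/-- The Lie derivative `L_X w = d i_X w - (-1)^k i_X d w` along a multivector field of degree `k`. -/
def lieDeriv (k : ℕ) (X : MVSection n M) (w : FormSection n M) : FormSection n M :=
  extD (interiorProd X w) - (-1 : ℝ) ^ k • interiorProd X (extD w)

variable (n M) in
/-- Higher affine connections `(X, Y) ↦ ∇_X Y` on `M`. -/
structure HigherConnection where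
  cov : MVField n M → MVField n M → MVField n M
  /-- `∇_X Y ∈ A^(k+l-1)(M)` for `X ∈ A^k(M)`, `Y ∈ A^l(M)`. (For `k = l = 0`, where
  `A^(-1)(M) = 0`, this is contained in `cov_fun`.) -/
  degree : ∀ (k l j : ℕ) (X Y : MVField n M), IsDegree k X → IsDegree l Y → j + 1 = k + l →
    IsDegree j (cov X Y)
  left_linear : ∀ (f : C^∞⟮𝓡 n, M; 𝓘(ℝ, ℝ), ℝ⟯) (X X' Y : MVField n M),
    cov (ofFun f * X + X') Y = ofFun f * cov X Y + cov X' Y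
  right_add : ∀ X Y Y' : MVField n M, cov X (Y + Y') = cov X Y + cov X Y'
  apply_fun : ∀ (k : ℕ) (X : MVField n M) (f : C^∞⟮𝓡 n, M; 𝓘(ℝ, ℝ), ℝ⟯), IsDegree k X →
    (cov X (ofFun f)).1 = schouten X.1 (ofFun f).1
  leibniz : ∀ (k : ℕ) (X : MVField n M) (f : C^∞⟮𝓡 n, M; 𝓘(ℝ, ℝ), ℝ⟯) (Y : MVField n M),
    IsDegree k X →
    (cov X (ofFun f * Y)).1 = schouten X.1 (ofFun f).1 * Y.1 + (ofFun f * cov X Y).1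
  cov_fun : ∀ (f : C^∞⟮𝓡 n, M; 𝓘(ℝ, ℝ), ℝ⟯) (X : MVField n M), cov (ofFun f) X = 0

namespace HigherConnection

/-- `∇` is induced:
`∇_{X∧Y} Z = X ∧ ∇_Y Z + (-1)^(kl) Y ∧ ∇_X Z` and
`∇_X (Y∧Z) = (∇_X Y) ∧ Z + (-1)^((k-1)l) Y ∧ ∇_X Z`. -/
structure IsInduced (D : HigherConnection n M) : Prop where
  lower : ∀ (k l : ℕ) (X Y Z : MVField n M), IsDegree k X → IsDegree l Y →
    D.cov (X * Y) Z = X * D.cov Y Z + (-1 : ℝ) ^ (k * l) • (Y * D.cov X Z)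
  upper : ∀ (k l : ℕ) (X Y Z : MVField n M), IsDegree k X → IsDegree l Y →
    D.cov X (Y * Z) =
      D.cov X Y * Z + (-1 : ℝ) ^ (((k : ℤ) - 1) * (l : ℤ)) • (Y * D.cov X Z)

/-- The higher torsion `T(X,Y) = ∇_X Y - (-1)^((k-1)(l-1)) ∇_Y X - [X,Y]` of `X ∈ A^k(M)`,
`Y ∈ A^l(M)`. -/
def torsion (D : HigherConnection n M) (k l : ℕ) (X Y : MVField n M) : MVSection n M :=
  (D.cov X Y).1 - (-1 : ℝ) ^ (((k : ℤ) - 1) * ((l : ℤ) - 1)) • (D.cov Y X).1 - schouten X.1 Y.1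

/-- `∇` is torsion-free. -/
def IsTorsionFree (D : HigherConnection n M) : Prop :=
  ∀ (k l : ℕ) (X Y : MVField n M), IsDegree k X → IsDegree l Y → D.torsion k l X Y = 0

/-- `h` is the covariant derivative `∇_X w` of the `m`-form `w` along `X ∈ A^k(M)`: the form of
degree `m - k + 1` with `h(Y) = (-1)^((k-1)(m-1)) L_X i_Y w - w(∇_X Y)` for all
`Y ∈ A^(m-k+1)(M)` if `k > 0`, and `0` if `k = 0` (or `m - k + 1 < 0`).
These conditions determine `h` pointwise, since every multivector is the value of a multivector
field; in particular the smoothness of `h` is automatic and need not be required.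
Here `L_X i_Y w` is a form of degree `0`, i.e. the function `x ↦ (L_X i_Y w)_x(1)`. -/
structure IsCovDeriv (D : HigherConnection n M) (k m : ℕ) (X : MVField n M)
    (w h : FormSection n M) : Prop where
  degree : ∀ (x : M) (j : ℕ), j + k ≠ m + 1 →
    ∀ v ∈ ⋀[ℝ]^j (TangentSpace (𝓡 n) x), h x v = 0
  apply : 0 < k → ∀ (j : ℕ) (Y : MVField n M), j + k = m + 1 → IsDegree j Y → ∀ x : M,
    h x (Y.1 x) = (-1 : ℝ) ^ (((k : ℤ) - 1) * ((m : ℤ) - 1)) *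
      lieDeriv k X.1 (interiorProd Y.1 w) x 1 - w x ((D.cov X Y).1 x)
  zero : k = 0 → h = 0

open Classical in
/-- The covariant derivative `∇_X w` of an `m`-form `w` along `X ∈ A^k(M)`. -/
def covForm (D : HigherConnection n M) (k m : ℕ) (X : MVField n M) (w : FormSection n M) :
    FormSection n M :=
  if h : ∃ η, D.IsCovDeriv k m X w η then h.choose else 0

end HigherConnection

end Manifold

end HigherConn

end

open HigherConn

noncomputable section

namespace HigherConn

/-! ### Graded algebra of the exterior algebra -/

section Algebra

variable {V : Type*} [AddCommGroup V] [Module ℝ V]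

/-! Evaluated on the constant 1, the term `d i_X` of a Lie derivative vanishes, because an exterior
derivative has no degree 0 component. For X of degree k > 0 the defining condition therefore reads
(∇_X ω)(Z) = (-1)^((k-1)m) d(i_Z ω)(X) - ω(∇_X Z); the right side is `covValue`.

Well-definedness is tensoriality in Z. Replacing Z by fZ creates two terms in [X, f], one from d and
one from the Leibniz rule of ∇, and they cancel exactly when deg Z = m - k + 1
(`covValue_mul_ofFun`). A bump-function argument (`eq_sum_frameField`) then shows that the value at
x depends only on Z at x, which gives a form (`exists_isCovDeriv`).

The product formula in positive degrees (`covValue_mul`) comes from Cartan's formula (`extD_mul`)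
for α = i_Z ω: up to signs, dα(X ∧ Y) is the sum of d(i_Y α)(X), d(i_X α)(Y) and α([X, Y]). Both
sides contain Y ∧ ∇_X Z and X ∧ ∇_Y Z, by the two induced rules. What remains is (∇_X Y) ∧ Z and
(∇_Y X) ∧ Z, which torsion-freeness combines into [X, Y] ∧ Z, the bracket term of Cartan's formula.
If a factor is a function, the formula is C^∞-linearity in X (`covValue_ofFun_mul`).

Both d and the bracket at x are computed in the chart at x, so these identities are checked there
and coordinate invariance is never needed; chart changes enter only in the smoothness of the cut-off
frame fields. -/

theorem exteriorPower_induction {k : ℕ} {p : ExteriorAlgebra ℝ V → Prop}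
    (hι : ∀ v : Fin k → V, p (ExteriorAlgebra.ιMulti ℝ k v))
    (zero : p 0) (add : ∀ a b, p a → p b → p (a + b)) (smul : ∀ (r : ℝ) a, p a → p (r • a))
    {a : ExteriorAlgebra ℝ V} (ha : a ∈ ⋀[ℝ]^k V) : p a := by
  rw [← ExteriorAlgebra.ιMulti_span_fixedDegree] at ha
  induction ha using Submodule.span_induction with
  | mem x hx => obtain ⟨v, rfl⟩ := hx; exact hι v
  | zero => exact zero
  | add x y _ _ hx hy => exact add x y hx hy
  | smul r x _ hx => exact smul r x hx

theorem mul_mem_exteriorPower {k l : ℕ} {a b : ExteriorAlgebra ℝ V} (ha : a ∈ ⋀[ℝ]^k V)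
    (hb : b ∈ ⋀[ℝ]^l V) : a * b ∈ ⋀[ℝ]^(k + l) V :=
  SetLike.mul_mem_graded (A := fun i : ℕ => ⋀[ℝ]^i V) ha hb

theorem ι_mul_comm (v : V) {l : ℕ} {b : ExteriorAlgebra ℝ V} (hb : b ∈ ⋀[ℝ]^l V) :
    ExteriorAlgebra.ι ℝ v * b = (-1 : ℝ) ^ l • (b * ExteriorAlgebra.ι ℝ v) := by
  refine exteriorPower_induction (p := fun b => ExteriorAlgebra.ι ℝ v * b =
    (-1 : ℝ) ^ l • (b * ExteriorAlgebra.ι ℝ v)) ?_ (by simp) ?_ ?_ hb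
  · intro u
    clear hb
    induction l with
    | zero => simp
    | succ l ih =>
      rw [ExteriorAlgebra.ιMulti_succ_apply, ← mul_assoc,
        eq_neg_of_add_eq_zero_left (ExteriorAlgebra.ι_add_mul_swap v (u 0)), neg_mul, mul_assoc, ih,
        pow_succ, mul_smul_comm, mul_assoc]
      simp
  · intro a b ha hb
    rw [mul_add, add_mul, smul_add, ha, hb]
  · intro r a ha
    rw [mul_smul_comm, smul_mul_assoc, ha, smul_comm]

theorem mul_comm_of_mem {k l : ℕ} {a b : ExteriorAlgebra ℝ V} (ha : a ∈ ⋀[ℝ]^k V)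
    (hb : b ∈ ⋀[ℝ]^l V) : a * b = (-1 : ℝ) ^ (k * l) • (b * a) := by
  refine exteriorPower_induction (p := fun a => a * b =
    (-1 : ℝ) ^ (k * l) • (b * a)) ?_ (by simp) ?_ ?_ ha
  · intro u
    clear ha
    induction k with
    | zero => simp
    | succ k ih =>
      rw [ExteriorAlgebra.ιMulti_succ_apply, mul_assoc, ih, mul_smul_comm, ← mul_assoc,
        ι_mul_comm _ hb, smul_mul_assoc, smul_smul, mul_assoc, ← pow_add, add_mul, one_mul]
  · intro a b ha hb
    rw [mul_add, add_mul, smul_add, ha, hb]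
  · intro r a ha
    rw [mul_smul_comm, smul_mul_assoc, ha, smul_comm]

theorem involute_of_mem {k : ℕ} {a : ExteriorAlgebra ℝ V} (ha : a ∈ ⋀[ℝ]^k V) :
    CliffordAlgebra.involute a = (-1 : ℝ) ^ k • a := by
  refine exteriorPower_induction (p := fun a => CliffordAlgebra.involute a = (-1 : ℝ) ^ k • a)
    ?_ (by simp) ?_ ?_ ha
  · intro u
    clear ha
    induction k with
    | zero => simp
    | succ k ih =>
      rw [ExteriorAlgebra.ιMulti_succ_apply, map_mul, ih, ExteriorAlgebra.ι,
        CliffordAlgebra.involute_ι, pow_succ]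
      simp
  · intro a b ha hb
    rw [map_add, smul_add, ha, hb]
  · intro r a ha
    rw [map_smul, ha, smul_comm]

theorem contractLeft_mul (d : Module.Dual ℝ V) (a b : ExteriorAlgebra ℝ V) :
    CliffordAlgebra.contractLeft d (a * b) =
      CliffordAlgebra.contractLeft d a * b +
        CliffordAlgebra.involute a * CliffordAlgebra.contractLeft d b := by
  induction a using CliffordAlgebra.left_induction generalizing b with
  | algebraMap r =>
    rw [CliffordAlgebra.contractLeft_algebraMap_mul, CliffordAlgebra.contractLeft_algebraMap,
      AlgHom.commutes, zero_mul, zero_add]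
  | add x y hx hy => simp only [add_mul, map_add, hx, hy]; abel
  | ι_mul x v hx =>
    rw [mul_assoc, CliffordAlgebra.contractLeft_ι_mul, hx, CliffordAlgebra.contractLeft_ι_mul,
      map_mul, CliffordAlgebra.involute_ι]
    simp only [mul_add, sub_mul, smul_mul_assoc, mul_assoc, neg_mul]
    abel

/-- This is the alternating sum that occurs in the exterior derivative of an alternating form, which
is what links contraction to d. -/
theorem contractLeft_ιMulti (d : Module.Dual ℝ V) {k : ℕ} (v : Fin (k + 1) → V) :
    CliffordAlgebra.contractLeft d (ExteriorAlgebra.ιMulti ℝ (k + 1) v) =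
      ∑ j : Fin (k + 1), ((-1 : ℝ) ^ (j : ℕ) * d (v j)) •
        ExteriorAlgebra.ιMulti ℝ k (j.removeNth v) := by
  induction k with
  | zero =>
    rw [ExteriorAlgebra.ιMulti_succ_apply, ExteriorAlgebra.ι, CliffordAlgebra.contractLeft_ι_mul]
    simp [CliffordAlgebra.contractLeft_one]
  | succ k ih =>
    rw [ExteriorAlgebra.ιMulti_succ_apply, ExteriorAlgebra.ι, CliffordAlgebra.contractLeft_ι_mul,
      Fin.sum_univ_succ, ih, Finset.mul_sum, sub_eq_add_neg, ← Finset.sum_neg_distrib]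
    congr 1
    · simp [Fin.removeNth_zero, Matrix.vecTail, Fin.tail_def]
      rfl
    · refine Finset.sum_congr rfl fun j _ => ?_
      rw [ExteriorAlgebra.ιMulti_succ_apply, mul_smul_comm, ← neg_smul, Fin.val_succ, pow_succ]
      congr 1
      · rw [mul_neg_one, neg_mul]
        rfl
      · congr 2
        funext i
        simp [Fin.removeNth, Matrix.vecTail]

theorem contractLeft_mem (d : Module.Dual ℝ V) {k : ℕ} {a : ExteriorAlgebra ℝ V}
    (ha : a ∈ ⋀[ℝ]^(k + 1) V) : CliffordAlgebra.contractLeft d a ∈ ⋀[ℝ]^k V := by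
  refine exteriorPower_induction (p := fun a => CliffordAlgebra.contractLeft d a ∈ ⋀[ℝ]^k V)
    ?_ (by simp) ?_ ?_ ha
  · intro u
    rw [contractLeft_ιMulti]
    exact Submodule.sum_mem _ fun j _ => Submodule.smul_mem _ _
      (ExteriorAlgebra.ιMulti_range ℝ k ⟨_, rfl⟩)
  · intro a b ha hb
    rw [map_add]
    exact Submodule.add_mem _ ha hb
  · intro r a ha
    rw [map_smul]
    exact Submodule.smul_mem _ _ ha

theorem map_mem_exteriorPower {W : Type*} [AddCommGroup W] [Module ℝ W] (f : V →ₗ[ℝ] W) {k : ℕ}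
    {a : ExteriorAlgebra ℝ V} (ha : a ∈ ⋀[ℝ]^k V) : ExteriorAlgebra.map f a ∈ ⋀[ℝ]^k W := by
  refine exteriorPower_induction (p := fun a => ExteriorAlgebra.map f a ∈ ⋀[ℝ]^k W)
    ?_ (by simp) ?_ ?_ ha
  · intro u
    rw [ExteriorAlgebra.map_apply_ιMulti]
    exact ExteriorAlgebra.ιMulti_range ℝ k ⟨_, rfl⟩
  · intro a b ha hb
    rw [map_add]
    exact Submodule.add_mem _ ha hb
  · intro r a ha
    rw [map_smul]
    exact Submodule.smul_mem _ _ ha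

end Algebra

/-! ### The basis e_S and the grading -/

theorem extBasis_apply {n : ℕ} (S : Finset (Fin n)) : extBasis n S =
    ExteriorAlgebra.ιMulti ℝ S.card
      (fun i => EuclideanSpace.single (S.orderEmbOfFin rfl i) (1 : ℝ)) := by
  rw [extBasis, ExteriorAlgebra.basis_apply_ofCard _ rfl, ExteriorAlgebra.ιMulti_family]
  congr 1
  funext i
  simp
  rfl

theorem extBasis_mem {n : ℕ} (S : Finset (Fin n)) : extBasis n S ∈ ⋀[ℝ]^S.card (Model n) := by
  rw [extBasis_apply]
  exact ExteriorAlgebra.ιMulti_range ℝ _ ⟨_, rfl⟩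

/-- The basis is collected from bases of the graded pieces, so a homogeneous element has no
components in other degrees. -/
theorem extBasis_repr_of_card_ne {n k : ℕ} {a : ExteriorAlgebra ℝ (Model n)}
    (ha : a ∈ ⋀[ℝ]^k (Model n)) {S : Finset (Fin n)} (hS : S.card ≠ k) :
    (extBasis n).repr a S = 0 := by
  rw [extBasis, Module.Basis.ExteriorAlgebra, Module.Basis.repr_reindex_apply,
    Set.powersetCard.prodEquiv_symm_apply]
  exact DirectSum.IsInternal.collectedBasis_repr_of_mem_ne _ _ (Ne.symm hS) ha

/-! ### Calculus in coordinates -/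

section Coordinates

variable {n : ℕ}

/-- The components of the multivector-valued function `u` are differentiable at `y`. -/
def MVDifferentiableAt (u : Model n → ExteriorAlgebra ℝ (Model n)) (y : Model n) : Prop :=
  ∀ S, DifferentiableAt ℝ (fun z => (extBasis n).repr (u z) S) y

/-- The components of the form `w` are differentiable at `y`. -/
def FormDifferentiableAt (w : Model n → Module.Dual ℝ (ExteriorAlgebra ℝ (Model n)))
    (y : Model n) : Prop :=
  ∀ S, DifferentiableAt ℝ (fun z => w z (extBasis n S)) y

/-- The partial derivative `∂_i w` at `y` of a differential form. -/
def formPartialDeriv (i : Fin n) (w : Model n → Module.Dual ℝ (ExteriorAlgebra ℝ (Model n)))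
    (y : Model n) : Module.Dual ℝ (ExteriorAlgebra ℝ (Model n)) :=
  ∑ S : Finset (Fin n),
    (fderiv ℝ (fun z => w z (extBasis n S)) y (EuclideanSpace.single i 1)) • (extBasis n).coord S

theorem dual_eq_sum (f : Module.Dual ℝ (ExteriorAlgebra ℝ (Model n))) :
    f = ∑ S, f (extBasis n S) • (extBasis n).coord S :=
  ((extBasis n).sum_dual_apply_smul_coord f).symm

theorem dual_apply_eq_sum (f : Module.Dual ℝ (ExteriorAlgebra ℝ (Model n)))
    (P : ExteriorAlgebra ℝ (Model n)) :
    f P = ∑ S, f (extBasis n S) * (extBasis n).repr P S := by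
  conv_lhs => rw [dual_eq_sum f]
  simp only [LinearMap.sum_apply, LinearMap.smul_apply, Module.Basis.coord_apply, smul_eq_mul]

theorem formPartialDeriv_apply_extBasis (i : Fin n)
    (w : Model n → Module.Dual ℝ (ExteriorAlgebra ℝ (Model n))) (y : Model n)
    (S : Finset (Fin n)) :
    formPartialDeriv i w y (extBasis n S) =
      fderiv ℝ (fun z => w z (extBasis n S)) y (EuclideanSpace.single i 1) := by
  simp [formPartialDeriv, Finsupp.single_apply]

theorem repr_partialDeriv (i : Fin n) (u : Model n → ExteriorAlgebra ℝ (Model n)) (y : Model n)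
    (S : Finset (Fin n)) :
    (extBasis n).repr (partialDeriv i u y) S =
      fderiv ℝ (fun z => (extBasis n).repr (u z) S) y (EuclideanSpace.single i 1) := by
  simp [partialDeriv, Finsupp.single_apply]

theorem FormDifferentiableAt.apply {w : Model n → Module.Dual ℝ (ExteriorAlgebra ℝ (Model n))}
    {u : Model n → ExteriorAlgebra ℝ (Model n)} {y : Model n}
    (hw : FormDifferentiableAt w y) (hu : MVDifferentiableAt u y) :
    DifferentiableAt ℝ (fun z => w z (u z)) y := by
  have h : (fun z => w z (u z)) =
      fun z => ∑ S, w z (extBasis n S) * (extBasis n).repr (u z) S :=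
    funext fun z => dual_apply_eq_sum _ _
  rw [h]
  exact DifferentiableAt.fun_sum fun S _ => (hw S).fun_mul (hu S)

/-- The pairing is a finite sum of products of components, so the Leibniz rule for scalar functions
applies. -/
theorem FormDifferentiableAt.fderiv_apply
    {w : Model n → Module.Dual ℝ (ExteriorAlgebra ℝ (Model n))}
    {u : Model n → ExteriorAlgebra ℝ (Model n)} {y : Model n}
    (hw : FormDifferentiableAt w y) (hu : MVDifferentiableAt u y) (i : Fin n) :
    fderiv ℝ (fun z => w z (u z)) y (EuclideanSpace.single i 1) =
      formPartialDeriv i w y (u y) + w y (partialDeriv i u y) := by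
  have h : (fun z => w z (u z)) =
      fun z => ∑ S, w z (extBasis n S) * (extBasis n).repr (u z) S :=
    funext fun z => dual_apply_eq_sum _ _
  rw [h, fderiv_fun_sum fun S _ => (hw S).fun_mul (hu S),
    dual_apply_eq_sum (formPartialDeriv i w y), dual_apply_eq_sum (w y), ← Finset.sum_add_distrib, sum_apply]
  refine Finset.sum_congr rfl fun S _ => ?_
  rw [fderiv_fun_mul (hw S) (hu S), formPartialDeriv_apply_extBasis, repr_partialDeriv]
  simp
  ring

theorem mvDifferentiableAt_const (P : ExteriorAlgebra ℝ (Model n)) (y : Model n) :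
    MVDifferentiableAt (fun _ => P) y :=
  fun _ => differentiableAt_const _

theorem repr_mul_eq_sum (P Q : ExteriorAlgebra ℝ (Model n)) (S : Finset (Fin n)) :
    (extBasis n).repr (P * Q) S = ∑ A, ∑ B, (extBasis n).repr P A *
      ((extBasis n).repr Q B * (extBasis n).repr (extBasis n A * extBasis n B) S) := by
  conv_lhs => rw [← (extBasis n).sum_repr P, ← (extBasis n).sum_repr Q]
  simp only [Finset.sum_mul_sum, map_sum, Finsupp.coe_finsetSum, Finset.sum_apply,
    smul_mul_smul_comm, map_smul, Finsupp.smul_apply, smul_eq_mul, mul_assoc]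

theorem MVDifferentiableAt.mul_const {u : Model n → ExteriorAlgebra ℝ (Model n)} {y : Model n}
    (hu : MVDifferentiableAt u y) (P : ExteriorAlgebra ℝ (Model n)) :
    MVDifferentiableAt (fun z => u z * P) y := by
  intro S
  refine DifferentiableAt.congr_of_eventuallyEq ?_
    (Filter.Eventually.of_forall fun z => repr_mul_eq_sum (u z) P S)
  exact DifferentiableAt.fun_sum fun A _ => DifferentiableAt.fun_sum fun B _ =>
    (hu A).fun_mul (differentiableAt_const _)

theorem partialDeriv_mul_const {u : Model n → ExteriorAlgebra ℝ (Model n)} {y : Model n}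
    (hu : MVDifferentiableAt u y) (P : ExteriorAlgebra ℝ (Model n)) (i : Fin n) :
    partialDeriv i (fun z => u z * P) y = partialDeriv i u y * P := by
  refine (extBasis n).ext_elem fun S => ?_
  rw [repr_partialDeriv, funext fun z => repr_mul_eq_sum (u z) P S, repr_mul_eq_sum,
    fderiv_fun_sum fun A _ => DifferentiableAt.fun_sum fun B _ =>
      (hu A).fun_mul (differentiableAt_const _), sum_apply]
  refine Finset.sum_congr rfl fun A _ => ?_
  rw [fderiv_fun_sum fun B _ => (hu A).fun_mul (differentiableAt_const _),
    sum_apply]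
  refine Finset.sum_congr rfl fun B _ => ?_
  rw [fderiv_mul_const (hu A), repr_partialDeriv]
  simp [mul_comm]

theorem FormDifferentiableAt.comp_mulLeft
    {w : Model n → Module.Dual ℝ (ExteriorAlgebra ℝ (Model n))}
    {u : Model n → ExteriorAlgebra ℝ (Model n)} {y : Model n}
    (hw : FormDifferentiableAt w y) (hu : MVDifferentiableAt u y) :
    FormDifferentiableAt (fun z => w z ∘ₗ LinearMap.mulLeft ℝ (u z)) y :=
  fun S => hw.apply (hu.mul_const (extBasis n S))

theorem formPartialDeriv_comp_mulLeft
    {w : Model n → Module.Dual ℝ (ExteriorAlgebra ℝ (Model n))}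
    {u : Model n → ExteriorAlgebra ℝ (Model n)} {y : Model n}
    (hw : FormDifferentiableAt w y) (hu : MVDifferentiableAt u y) (i : Fin n)
    (P : ExteriorAlgebra ℝ (Model n)) :
    formPartialDeriv i (fun z => w z ∘ₗ LinearMap.mulLeft ℝ (u z)) y P =
      formPartialDeriv i w y (u y * P) + w y (partialDeriv i u y * P) := by
  suffices formPartialDeriv i (fun z => w z ∘ₗ LinearMap.mulLeft ℝ (u z)) y =
      formPartialDeriv i w y ∘ₗ LinearMap.mulLeft ℝ (u y) +
        w y ∘ₗ LinearMap.mulLeft ℝ (partialDeriv i u y) from LinearMap.congr_fun this P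
  refine (extBasis n).ext fun S => ?_
  rw [formPartialDeriv_apply_extBasis]
  exact (hw.fderiv_apply (hu.mul_const (extBasis n S)) i).trans
    (by rw [partialDeriv_mul_const hu]; rfl)

theorem partialDeriv_mem {k : ℕ} {u : Model n → ExteriorAlgebra ℝ (Model n)} {y : Model n}
    (hu : ∀ z, u z ∈ ⋀[ℝ]^k (Model n)) (i : Fin n) :
    partialDeriv i u y ∈ ⋀[ℝ]^k (Model n) := by
  refine Submodule.sum_mem _ fun S _ => ?_
  by_cases hS : S.card = k
  · exact Submodule.smul_mem _ _ (hS ▸ extBasis_mem S)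
  · simp [extBasis_repr_of_card_ne (hu _) hS]

/-! ### The exterior derivative in coordinates -/

theorem fderiv_eq_sum_single (f : Model n → ℝ) (y v : Model n) :
    fderiv ℝ f y v = ∑ i, v i * fderiv ℝ f y (EuclideanSpace.single i 1) := by
  conv_lhs => rw [← (EuclideanSpace.basisFun (Fin n) ℝ).sum_repr v, map_sum]
  simp

/-- The alternating `j`-form underlying a linear functional on the exterior algebra. -/
def alternatingComponent (j : ℕ) :
    Module.Dual ℝ (ExteriorAlgebra ℝ (Model n)) →ₗ[ℝ] Model n [⋀^Fin j]→L[ℝ] ℝ where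
  toFun f := toContinuousAlternating (f.compAlternatingMap (ExteriorAlgebra.ιMulti ℝ j))
  map_add' _ _ := rfl
  map_smul' _ _ := rfl

theorem FormDifferentiableAt.alternatingComponent
    {w : Model n → Module.Dual ℝ (ExteriorAlgebra ℝ (Model n))} {y : Model n}
    (hw : FormDifferentiableAt w y) (j : ℕ) :
    DifferentiableAt ℝ (fun z => alternatingComponent j (w z)) y := by
  have h : (fun z => HigherConn.alternatingComponent j (w z)) = fun z =>
      ∑ S, w z (extBasis n S) • HigherConn.alternatingComponent j ((extBasis n).coord S) := by
    funext z
    conv_lhs => rw [dual_eq_sum (w z)]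
    simp only [map_sum, map_smul]
  rw [h]
  exact DifferentiableAt.fun_sum fun S _ => (hw S).smul_const _

/-- This is dw = ∑ dxⁱ ∧ ∂ᵢw in dual form. It suffices to test on v₁ ∧ ⋯ ∧ vⱼ, where the directional
derivatives along the vᵣ expand into partial derivatives. -/
theorem extDerivCoord_apply {w : Model n → Module.Dual ℝ (ExteriorAlgebra ℝ (Model n))}
    {y : Model n} (hw : FormDifferentiableAt w y) (P : ExteriorAlgebra ℝ (Model n)) :
    extDerivCoord w y P = ∑ i, formPartialDeriv i w y (contractDx i P) := by
  suffices extDerivCoord w y = ∑ i, formPartialDeriv i w y ∘ₗ contractDx i by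
    rw [this]; simp
  refine ExteriorAlgebra.lhom_ext fun j => ?_
  ext v
  rw [LinearMap.compAlternatingMap_apply, LinearMap.compAlternatingMap_apply, extDerivCoord,
    ExteriorAlgebra.liftAlternating_apply_ιMulti]
  cases j with
  | zero => simp [contractDx, CliffordAlgebra.contractLeft_one]
  | succ j =>
    change extDeriv (fun z => alternatingComponent j (w z)) y v = _
    rw [extDeriv_apply (hw.alternatingComponent j)]
    simp only [LinearMap.sum_apply, LinearMap.comp_apply, contractDx, contractLeft_ιMulti,
      map_sum, map_smul]
    rw [Finset.sum_comm]
    refine Finset.sum_congr rfl fun r _ => ?_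
    rw [fderiv_eq_sum_single, Finset.smul_sum]
    refine Finset.sum_congr rfl fun i _ => ?_
    have h := hw.fderiv_apply (mvDifferentiableAt_const
      (ExteriorAlgebra.ιMulti ℝ j (r.removeNth v)) y) i
    have h0 : partialDeriv i
        (fun _ => ExteriorAlgebra.ιMulti ℝ j (r.removeNth v)) y = 0 := by
      simp [partialDeriv]
    rw [h0, map_zero, add_zero] at h
    change _ • (_ * fderiv ℝ (fun z => w z (ExteriorAlgebra.ιMulti ℝ j (r.removeNth v))) y
      (EuclideanSpace.single i 1)) = _
    rw [h]
    simp [mul_assoc]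

theorem extDerivCoord_comp_mulLeft
    {w : Model n → Module.Dual ℝ (ExteriorAlgebra ℝ (Model n))}
    {u : Model n → ExteriorAlgebra ℝ (Model n)} {y : Model n}
    (hw : FormDifferentiableAt w y) (hu : MVDifferentiableAt u y)
    (P : ExteriorAlgebra ℝ (Model n)) :
    extDerivCoord (fun z => w z ∘ₗ LinearMap.mulLeft ℝ (u z)) y P =
      ∑ i, (formPartialDeriv i w y (u y * contractDx i P) +
        w y (partialDeriv i u y * contractDx i P)) := by
  rw [extDerivCoord_apply (hw.comp_mulLeft hu)]
  exact Finset.sum_congr rfl fun i _ => formPartialDeriv_comp_mulLeft hw hu i _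

/-- Cartan's formula for the exterior derivative on a product of multivector fields of positive
degrees. -/
theorem extDerivCoord_mul {k l : ℕ}
    {w : Model n → Module.Dual ℝ (ExteriorAlgebra ℝ (Model n))}
    {p q : Model n → ExteriorAlgebra ℝ (Model n)} {y : Model n}
    (hw : FormDifferentiableAt w y) (hp : MVDifferentiableAt p y) (hq : MVDifferentiableAt q y)
    (hpk : ∀ z, p z ∈ ⋀[ℝ]^(k + 1) (Model n)) (hql : ∀ z, q z ∈ ⋀[ℝ]^(l + 1) (Model n)) :
    extDerivCoord w y (p y * q y) =
      (-1 : ℝ) ^ ((l + 1) * k) *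
          extDerivCoord (fun z => w z ∘ₗ LinearMap.mulLeft ℝ (q z)) y (p y) +
        (-1 : ℝ) ^ (k + 1) *
          extDerivCoord (fun z => w z ∘ₗ LinearMap.mulLeft ℝ (p z)) y (q y) +
        (-1 : ℝ) ^ (k + 1) * w y (schoutenCoord p q y) := by
  rw [extDerivCoord_apply hw, extDerivCoord_comp_mulLeft hw hq, extDerivCoord_comp_mulLeft hw hp,
    schoutenCoord, map_sum, Finset.mul_sum, Finset.mul_sum, Finset.mul_sum,
    ← Finset.sum_add_distrib, ← Finset.sum_add_distrib]
  -- Cartan's formula holds separately for each coordinate index: the derivatives of w match by the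
  -- antiderivation rule, and the derivatives of p and q cancel against the bracket.
  refine Finset.sum_congr rfl fun i _ => ?_
  have hξ : contractDx i (p y) ∈ ⋀[ℝ]^k (Model n) := contractLeft_mem _ (hpk y)
  have hmul : contractDx i (p y * q y) = contractDx i (p y) * q y +
      (-1 : ℝ) ^ (k + 1) • (p y * contractDx i (q y)) := by
    rw [contractDx, contractLeft_mul, involute_of_mem (hpk y), smul_mul_assoc]
  -- Moving dxⁱ ⌋ p to the left of q and of ∂ᵢq produces the sign (-1)^((l+1)k).
  rw [hmul, mul_comm_of_mem (hql y) hξ, mul_comm_of_mem (partialDeriv_mem hql i) hξ,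
    involute_of_mem hξ]
  simp only [map_add, map_sub, map_smul, smul_mul_assoc, smul_eq_mul, pow_succ]
  rcases neg_one_pow_eq_or ℝ k with hk | hk <;> rcases neg_one_pow_eq_or ℝ ((l + 1) * k) with hl | hl <;>
    rw [hk, hl] <;> ring

end Coordinates

/-! ### Sections in charts -/

section Charts

variable {n : ℕ} {M : Type*} [TopologicalSpace M] [ChartedSpace (Model n) M]

theorem differentiableAt_comp_extChartAt_symm {f : M → ℝ} {x : M}
    (hf : ContMDiffAt (𝓡 n) 𝓘(ℝ, ℝ) ∞ f x) :
    DifferentiableAt ℝ (fun y => f ((extChartAt (𝓡 n) x).symm y)) (extChartAt (𝓡 n) x x) := by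
  have h := (contMDiffAt_iff.1 hf).2
  rw [ModelWithCorners.range_eq_univ, contDiffWithinAt_univ] at h
  exact h.differentiableAt (by simp)

theorem eventually_extChartAt_symm_mem (x : M) : ∀ᶠ y in nhds (extChartAt (𝓡 n) x x),
    (extChartAt (𝓡 n) x).symm y ∈ (chartAt (Model n) x).source := by
  have h := continuousAt_extChartAt_symm (I := 𝓡 n) x
  refine h.eventually ?_
  rw [extChartAt_to_inv]
  exact (chartAt (Model n) x).open_source.mem_nhds (mem_chart_source _ x)

variable [IsManifold (𝓡 n) ∞ M]

/-- The multivector field `X` in the chart at `x`. -/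
def chartMV (x : M) (X : MVSection n M) (y : Model n) : ExteriorAlgebra ℝ (Model n) :=
  toChart x ((extChartAt (𝓡 n) x).symm y) (X ((extChartAt (𝓡 n) x).symm y))

/-- The form `w` in the chart at `x`. -/
def chartForm (x : M) (w : FormSection n M) (y : Model n) :
    Module.Dual ℝ (ExteriorAlgebra ℝ (Model n)) :=
  w ((extChartAt (𝓡 n) x).symm y) ∘ₗ (fromChart x ((extChartAt (𝓡 n) x).symm y)).toLinearMap

theorem fromChart_toChart {x p : M} (hp : p ∈ (chartAt (Model n) x).source)
    (a : ExteriorAlgebra ℝ (TangentSpace (𝓡 n) p)) : fromChart x p (toChart x p a) = a := by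
  have h : ((trivializationAt (Model n) (TangentSpace (𝓡 n)) x).symmL ℝ p).toLinearMap ∘ₗ
      ((trivializationAt (Model n) (TangentSpace (𝓡 n)) x).continuousLinearMapAt ℝ p).toLinearMap =
      LinearMap.id :=
    LinearMap.ext fun v => Bundle.Trivialization.symmL_continuousLinearMapAt _ hp v
  rw [fromChart, toChart, ← AlgHom.comp_apply, ExteriorAlgebra.map_comp_map, h,
    ExteriorAlgebra.map_id, AlgHom.id_apply]

theorem toChart_mem {x p : M} {k : ℕ} {a : ExteriorAlgebra ℝ (TangentSpace (𝓡 n) p)}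
    (ha : a ∈ ⋀[ℝ]^k (TangentSpace (𝓡 n) p)) : toChart x p a ∈ ⋀[ℝ]^k (Model n) :=
  map_mem_exteriorPower _ ha

theorem fromChart_mem {x p : M} {k : ℕ} {a : ExteriorAlgebra ℝ (Model n)}
    (ha : a ∈ ⋀[ℝ]^k (Model n)) : fromChart x p a ∈ ⋀[ℝ]^k (TangentSpace (𝓡 n) p) :=
  map_mem_exteriorPower _ ha

theorem chartMV_apply_self (x : M) (X : MVSection n M) :
    chartMV x X (extChartAt (𝓡 n) x x) = toChart x x (X x) := by
  rw [chartMV, extChartAt_to_inv]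

theorem chartForm_apply_self (x : M) (w : FormSection n M)
    (a : ExteriorAlgebra ℝ (Model n)) :
    chartForm x w (extChartAt (𝓡 n) x x) a = w x (fromChart x x a) := by
  rw [chartForm, extChartAt_to_inv]
  rfl

theorem IsSmoothMV.differentiableAt {X : MVSection n M} (hX : IsSmoothMV X) (x : M) :
    MVDifferentiableAt (chartMV x X) (extChartAt (𝓡 n) x x) :=
  fun S => differentiableAt_comp_extChartAt_symm (hX x S)

theorem IsSmoothForm.differentiableAt {w : FormSection n M} (hw : IsSmoothForm w) (x : M) :
    FormDifferentiableAt (chartForm x w) (extChartAt (𝓡 n) x x) :=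
  fun S => differentiableAt_comp_extChartAt_symm (hw x S)

/-- The two chart maps are mutually inverse only over the chart domain, so equality holds only near
the point; this is enough for taking derivatives. -/
theorem chartForm_interiorProd (x : M) (X : MVSection n M) (w : FormSection n M) :
    chartForm x (interiorProd X w) =ᶠ[nhds (extChartAt (𝓡 n) x x)]
      fun y => chartForm x w y ∘ₗ LinearMap.mulLeft ℝ (chartMV x X y) := by
  filter_upwards [eventually_extChartAt_symm_mem x] with y hy
  refine LinearMap.ext fun a => ?_
  change w _ (X _ * fromChart x _ a) = w _ (fromChart x _ (toChart x _ (X _) * a))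
  rw [map_mul (fromChart x _), fromChart_toChart hy]

theorem extDerivCoord_congr {w w' : Model n → Module.Dual ℝ (ExteriorAlgebra ℝ (Model n))}
    {y : Model n} (h : w =ᶠ[nhds y] w') : extDerivCoord w y = extDerivCoord w' y := by
  unfold extDerivCoord
  congr 1
  funext j
  cases j with
  | zero => rfl
  | succ j =>
    have h' : (fun z => toContinuousAlternating
        ((w z).compAlternatingMap (ExteriorAlgebra.ιMulti ℝ j))) =ᶠ[nhds y]
        (fun z => toContinuousAlternating
        ((w' z).compAlternatingMap (ExteriorAlgebra.ιMulti ℝ j))) := by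
      filter_upwards [h] with z hz
      rw [hz]
    exact congrArg ContinuousAlternatingMap.toAlternatingMap h'.extDeriv_eq

theorem extD_interiorProd (x : M) (X : MVSection n M) (w : FormSection n M)
    (a : ExteriorAlgebra ℝ (TangentSpace (𝓡 n) x)) :
    extD (interiorProd X w) x a = extDerivCoord
      (fun y => chartForm x w y ∘ₗ LinearMap.mulLeft ℝ (chartMV x X y))
      (extChartAt (𝓡 n) x x) (toChart x x a) := by
  rw [← extDerivCoord_congr (chartForm_interiorProd x X w)]
  rfl

theorem FormDifferentiableAt.chartForm_interiorProd {x : M} {X : MVSection n M}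
    {w : FormSection n M} (hX : MVDifferentiableAt (chartMV x X) (extChartAt (𝓡 n) x x))
    (hw : FormDifferentiableAt (chartForm x w) (extChartAt (𝓡 n) x x)) :
    FormDifferentiableAt (chartForm x (interiorProd X w)) (extChartAt (𝓡 n) x x) := by
  intro S
  refine (hw.comp_mulLeft hX S).congr_of_eventuallyEq ?_
  filter_upwards [HigherConn.chartForm_interiorProd x X w] with y hy
  rw [hy]

/-- Degree 0 of an exterior derivative is zero; this removes `d i_X` from the Lie derivative
evaluated on 1. -/
theorem extD_apply_one (w : FormSection n M) (x : M) : extD w x 1 = 0 := by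
  simp [extD, extDerivCoord, ExteriorAlgebra.liftAlternating_one]

/-- Cartan's formula for multivector fields of positive degrees. -/
theorem extD_mul {k l : ℕ} {X Y : MVSection n M} {w : FormSection n M} {x : M}
    (hX : IsSmoothMV X) (hY : IsSmoothMV Y)
    (hw : FormDifferentiableAt (chartForm x w) (extChartAt (𝓡 n) x x))
    (hXk : ∀ p, X p ∈ ⋀[ℝ]^(k + 1) (TangentSpace (𝓡 n) p))
    (hYl : ∀ p, Y p ∈ ⋀[ℝ]^(l + 1) (TangentSpace (𝓡 n) p)) :
    extD w x (X x * Y x) =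
      (-1 : ℝ) ^ ((l + 1) * k) * extD (interiorProd Y w) x (X x) +
        (-1 : ℝ) ^ (k + 1) * extD (interiorProd X w) x (Y x) +
        (-1 : ℝ) ^ (k + 1) * w x (schouten X Y x) := by
  have h := extDerivCoord_mul hw (hX.differentiableAt x) (hY.differentiableAt x)
    (fun z => toChart_mem (hXk _)) (fun z => toChart_mem (hYl _))
  rw [chartMV_apply_self, chartMV_apply_self, ← map_mul, chartForm_apply_self,
    ← extD_interiorProd, ← extD_interiorProd] at h
  exact h

theorem extD_interiorProd_apply {X : MVSection n M} {w : FormSection n M} {x : M}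
    (hX : MVDifferentiableAt (chartMV x X) (extChartAt (𝓡 n) x x))
    (hw : FormDifferentiableAt (chartForm x w) (extChartAt (𝓡 n) x x))
    (a : ExteriorAlgebra ℝ (TangentSpace (𝓡 n) x)) :
    extD (interiorProd X w) x a =
      ∑ i, (formPartialDeriv i (chartForm x w) (extChartAt (𝓡 n) x x)
          (toChart x x (X x) * contractDx i (toChart x x a)) +
        w x (fromChart x x (partialDeriv i (chartMV x X) (extChartAt (𝓡 n) x x) *
          contractDx i (toChart x x a)))) := by
  rw [extD_interiorProd, extDerivCoord_comp_mulLeft hw hX, chartMV_apply_self]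
  simp only [chartForm_apply_self]

theorem extD_interiorProd_add {X X' : MVSection n M} {w : FormSection n M} {x : M}
    (hX : IsSmoothMV X) (hX' : IsSmoothMV X') (hXX' : IsSmoothMV (X + X'))
    (hw : FormDifferentiableAt (chartForm x w) (extChartAt (𝓡 n) x x))
    (a : ExteriorAlgebra ℝ (TangentSpace (𝓡 n) x)) :
    extD (interiorProd (X + X') w) x a =
      extD (interiorProd X w) x a + extD (interiorProd X' w) x a := by
  have h : ∀ i, partialDeriv i (chartMV x (X + X')) (extChartAt (𝓡 n) x x) =
      partialDeriv i (chartMV x X) (extChartAt (𝓡 n) x x) +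
        partialDeriv i (chartMV x X') (extChartAt (𝓡 n) x x) := by
    intro i
    refine (extBasis n).ext_elem fun S => ?_
    rw [map_add, Finsupp.add_apply, repr_partialDeriv, repr_partialDeriv, repr_partialDeriv,
      ← add_apply,
      ← fderiv_fun_add (hX.differentiableAt x S) (hX'.differentiableAt x S)]
    congr 2
    funext z
    rw [chartMV, Pi.add_apply, map_add, map_add, Finsupp.add_apply]
    rfl
  rw [extD_interiorProd_apply (hXX'.differentiableAt x) hw,
    extD_interiorProd_apply (hX.differentiableAt x) hw,
    extD_interiorProd_apply (hX'.differentiableAt x) hw, ← Finset.sum_add_distrib]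
  refine Finset.sum_congr rfl fun i _ => ?_
  rw [h, Pi.add_apply, map_add, add_mul, add_mul, map_add, map_add, map_add]
  abel

/-! ### Multiplication by functions -/

theorem ofFun_apply (f : C^∞⟮𝓡 n, M; 𝓘(ℝ, ℝ), ℝ⟯) (p : M) :
    (ofFun f).1 p = algebraMap ℝ _ (f p) := rfl

theorem ofFun_mul_apply (f : C^∞⟮𝓡 n, M; 𝓘(ℝ, ℝ), ℝ⟯) (X : MVField n M) (p : M) :
    (ofFun f * X).1 p = f p • X.1 p := by
  change algebraMap ℝ _ (f p) * X.1 p = _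
  rw [Algebra.smul_def]

/-- The partial derivatives of a function in the chart at `x`. -/
def funPartialDeriv (x : M) (f : M → ℝ) (i : Fin n) : ℝ :=
  fderiv ℝ (fun y => f ((extChartAt (𝓡 n) x).symm y)) (extChartAt (𝓡 n) x x)
    (EuclideanSpace.single i 1)

theorem partialDeriv_ofFun_mul (f : C^∞⟮𝓡 n, M; 𝓘(ℝ, ℝ), ℝ⟯) (X : MVField n M) (x : M)
    (i : Fin n) :
    partialDeriv i (chartMV x (ofFun f * X).1) (extChartAt (𝓡 n) x x) =
      funPartialDeriv x f i • toChart x x (X.1 x) +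
        f x • partialDeriv i (chartMV x X.1) (extChartAt (𝓡 n) x x) := by
  refine (extBasis n).ext_elem fun S => ?_
  have h : (fun z => (extBasis n).repr (chartMV x (ofFun f * X).1 z) S) =
      fun z => f ((extChartAt (𝓡 n) x).symm z) * (extBasis n).repr (chartMV x X.1 z) S := by
    funext z
    rw [chartMV, ofFun_mul_apply, map_smul, map_smul]
    rfl
  rw [repr_partialDeriv, h, fderiv_fun_mul (differentiableAt_comp_extChartAt_symm
    f.contMDiff.contMDiffAt) (IsSmoothMV.differentiableAt X.2 x S), extChartAt_to_inv,
    chartMV_apply_self]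
  simp only [map_add, map_smul, Finsupp.add_apply, Finsupp.smul_apply, smul_eq_mul,
    add_apply, smul_apply, repr_partialDeriv,
    funPartialDeriv]
  ring

theorem schouten_ofFun {k : ℕ} {X : MVSection n M}
    (hXk : ∀ p, X p ∈ ⋀[ℝ]^(k + 1) (TangentSpace (𝓡 n) p))
    (f : C^∞⟮𝓡 n, M; 𝓘(ℝ, ℝ), ℝ⟯) (x : M) :
    schouten X (ofFun f).1 x = (-1 : ℝ) ^ k • fromChart x x
      (∑ i, funPartialDeriv x f i • contractDx i (toChart x x (X x))) := by
  have h1 : ∀ i, partialDeriv i (chartMV x (ofFun f).1) (extChartAt (𝓡 n) x x) =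
      algebraMap ℝ _ (funPartialDeriv x f i) := by
    intro i
    -- The Leibniz rule with X = 1, whose partial derivatives vanish, gives the derivative of f
    -- itself.
    have h := partialDeriv_ofFun_mul f 1 x i
    have h0 : partialDeriv i (chartMV x (1 : MVField n M).1) (extChartAt (𝓡 n) x x) = 0 := by
      have h2 : chartMV x (1 : MVField n M).1 = fun _ => 1 := funext fun _ => map_one _
      rw [h2]
      simp [partialDeriv]
    rw [mul_one, h0, smul_zero, add_zero] at h
    rw [h, Algebra.algebraMap_eq_smul_one]
    simp
  change fromChart x x (schoutenCoord (chartMV x X) (chartMV x (ofFun f).1) _) = _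
  rw [← map_smul, schoutenCoord, Finset.smul_sum]
  congr 1
  refine Finset.sum_congr rfl fun i _ => ?_
  have h2 : contractDx i (chartMV x (ofFun f).1 (extChartAt (𝓡 n) x x)) = 0 := by
    rw [chartMV_apply_self, ofFun_apply, AlgHom.commutes, contractDx]
    exact CliffordAlgebra.contractLeft_algebraMap _ _ _
  have h3 : contractDx i (toChart x x (X x)) ∈ ⋀[ℝ]^k (Model n) :=
    contractLeft_mem _ (toChart_mem (hXk x))
  rw [h2, h1, mul_zero, sub_zero, chartMV_apply_self, involute_of_mem h3, ← Algebra.commutes,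
    ← Algebra.smul_def, smul_comm]

/-- The failure of C^∞-linearity comes from the derivatives of f alone; they contract with X into
the bracket [X, f]. -/
theorem extD_interiorProd_ofFun_mul {k : ℕ} {X : MVSection n M}
    (hXk : ∀ p, X p ∈ ⋀[ℝ]^(k + 1) (TangentSpace (𝓡 n) p))
    (f : C^∞⟮𝓡 n, M; 𝓘(ℝ, ℝ), ℝ⟯) (Y : MVField n M) {w : FormSection n M} {x : M}
    (hw : FormDifferentiableAt (chartForm x w) (extChartAt (𝓡 n) x x)) :
    extD (interiorProd (ofFun f * Y).1 w) x (X x) =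
      f x * extD (interiorProd Y.1 w) x (X x) +
        (-1 : ℝ) ^ k * w x (Y.1 x * schouten X (ofFun f).1 x) := by
  have hYd : MVDifferentiableAt (chartMV x Y.1) (extChartAt (𝓡 n) x x) :=
    IsSmoothMV.differentiableAt Y.2 x
  have hfYd : MVDifferentiableAt (chartMV x (ofFun f * Y).1) (extChartAt (𝓡 n) x x) :=
    IsSmoothMV.differentiableAt (ofFun f * Y).2 x
  have hs : (-1 : ℝ) ^ k * (-1 : ℝ) ^ k = 1 := by rw [← mul_pow]; norm_num
  have hYs : (-1 : ℝ) ^ k * w x (Y.1 x * schouten X (ofFun f).1 x) =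
      ∑ i, funPartialDeriv x f i *
        w x (fromChart x x (toChart x x (Y.1 x) * contractDx i (toChart x x (X x)))) := by
    rw [schouten_ofFun hXk, mul_smul_comm, map_smul, smul_eq_mul, ← mul_assoc, hs, one_mul,
      map_sum, Finset.mul_sum, map_sum]
    refine Finset.sum_congr rfl fun i _ => ?_
    rw [map_smul, mul_smul_comm, map_smul, map_mul (fromChart x x),
      fromChart_toChart (mem_chart_source _ x), smul_eq_mul]
  rw [hYs, extD_interiorProd_apply hfYd hw, extD_interiorProd_apply hYd hw, Finset.mul_sum,
    ← Finset.sum_add_distrib]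
  refine Finset.sum_congr rfl fun i _ => ?_
  rw [partialDeriv_ofFun_mul, ofFun_mul_apply]
  simp only [add_mul, map_add, map_smul, smul_mul_assoc, smul_eq_mul]
  ring

theorem lieDeriv_apply_one (k : ℕ) (X : MVSection n M) (w : FormSection n M) (x : M) :
    lieDeriv k X w x 1 = (-1 : ℝ) ^ (k + 1) * extD w x (X x) := by
  simp [lieDeriv, interiorProd, extD_apply_one, pow_succ]

end Charts

/-! ### Global frames -/

section Frames

variable {n : ℕ} {M : Type*} [TopologicalSpace M] [ChartedSpace (Model n) M]
  [IsManifold (𝓡 n) ∞ M]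

/-- The matrix of a chart change on the exterior algebra is multilinear in the images of the basis
vectors under the tangent coordinate change, which are smooth. -/
theorem contMDiffAt_repr_toChart_fromChart {x y q : M} (hx : q ∈ (chartAt (Model n) x).source)
    (hy : q ∈ (chartAt (Model n) y).source) (A B : Finset (Fin n)) :
    ContMDiffAt (𝓡 n) 𝓘(ℝ, ℝ) ∞
      (fun p => (extBasis n).repr (toChart y p (fromChart x p (extBasis n A))) B) q := by
  let e := trivializationAt (Model n) (TangentSpace (𝓡 n) : M → Type _) x
  let e' := trivializationAt (Model n) (TangentSpace (𝓡 n) : M → Type _) y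
  have hc : ContMDiffAt (𝓡 n) 𝓘(ℝ, Model n →L[ℝ] Model n) ∞
      (fun p : M => (e.coordChangeL ℝ e' p : Model n →L[ℝ] Model n)) q :=
    contMDiffAt_coordChangeL (IB := 𝓡 n) (n := ∞) (e := e) (e' := e') hx hy
  let v : Fin A.card → Model n := fun i => EuclideanSpace.single (A.orderEmbOfFin rfl i) 1
  have hv : ContMDiffAt (𝓡 n) 𝓘(ℝ, Fin A.card → Model n) ∞
      (fun p : M => fun i => e.coordChangeL ℝ e' p (v i)) q :=
    contMDiffAt_pi_space.2 fun i => hc.clm_apply contMDiffAt_const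
  have hf := (alternatingComponent A.card
    ((extBasis n).coord B)).toContinuousMultilinearMap.contDiff (n := ∞)
  refine (hf.contMDiff.contMDiffAt.comp q hv).congr_of_eventuallyEq ?_
  filter_upwards [(chartAt (Model n) x).open_source.mem_nhds hx,
    (chartAt (Model n) y).open_source.mem_nhds hy] with p hpx hpy
  rw [extBasis_apply, fromChart, toChart, ExteriorAlgebra.map_apply_ιMulti,
    ExteriorAlgebra.map_apply_ιMulti]
  change _ = (extBasis n).repr (ExteriorAlgebra.ιMulti ℝ A.card
    (fun i => e.coordChangeL ℝ e' p (v i))) B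
  congr 3
  funext i
  rw [Bundle.Trivialization.coordChangeL_apply e e' ⟨hpx, hpy⟩]
  change e'.continuousLinearMapAt ℝ p (e.symmL ℝ p (v i)) = _
  rw [Bundle.Trivialization.symmL_apply e hpx]
  exact congrFun (Bundle.Trivialization.coe_linearMapAt_of_mem e' hpy) _

/-- The definition tests the components in a chart only at its centre; the smooth change of frame
extends this to the whole chart domain. -/
theorem IsSmoothMV.contMDiffAt_repr {X : MVSection n M} (hX : IsSmoothMV X) {x q : M}
    (hq : q ∈ (chartAt (Model n) x).source) (S : Finset (Fin n)) :
    ContMDiffAt (𝓡 n) 𝓘(ℝ, ℝ) ∞ (fun p => (extBasis n).repr (toChart x p (X p)) S) q := by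
  have h : ContMDiffAt (𝓡 n) 𝓘(ℝ, ℝ) ∞ (fun p => ∑ A,
      (extBasis n).repr (toChart q p (X p)) A *
        (extBasis n).repr (toChart x p (fromChart q p (extBasis n A))) S) q :=
    contMDiffAt_finsetSum fun A _ => (hX q A).mul
      (contMDiffAt_repr_toChart_fromChart (mem_chart_source _ q) hq A S)
  refine h.congr_of_eventuallyEq ?_
  filter_upwards [(chartAt (Model n) q).open_source.mem_nhds (mem_chart_source _ q)] with p hp
  conv_lhs => rw [← fromChart_toChart hp (X p), ← (extBasis n).sum_repr (toChart q p (X p))]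
  simp only [map_sum, map_smul, Finsupp.coe_finsetSum, Finset.sum_apply, Finsupp.smul_apply,
    smul_eq_mul]

variable [T2Space M]

/-- The coordinate multivector field `∂_S` of the chart at `x`, cut off by a bump function. -/
def frameField {x : M} (ψ : SmoothBumpFunction (𝓡 n) x) (S : Finset (Fin n)) : MVField n M :=
  ⟨fun p => ψ p • fromChart x p (extBasis n S), by
    intro y B
    -- On the support the chart at x is available; off it the field vanishes near y.
    by_cases hy : y ∈ tsupport ψ
    · have h := (ψ.contMDiff.contMDiffAt (x := y)).mul (contMDiffAt_repr_toChart_fromChart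
        (ψ.tsupport_subset_chartAt_source hy) (mem_chart_source (Model n) y) S B)
      refine h.congr_of_eventuallyEq (Filter.Eventually.of_forall fun p => ?_)
      simp
    · refine (contMDiffAt_const (c := (0 : ℝ))).congr_of_eventuallyEq ?_
      filter_upwards [(isClosed_tsupport ψ).isOpen_compl.mem_nhds hy] with p hp
      simp [image_eq_zero_of_notMem_tsupport hp]⟩

theorem frameField_apply {x : M} (ψ : SmoothBumpFunction (𝓡 n) x) (S : Finset (Fin n)) (p : M) :
    (frameField ψ S).1 p = ψ p • fromChart x p (extBasis n S) := rfl

theorem frameField_apply_self {x : M} (ψ : SmoothBumpFunction (𝓡 n) x) (S : Finset (Fin n)) :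
    (frameField ψ S).1 x = fromChart x x (extBasis n S) := by
  rw [frameField_apply, ψ.eq_one, one_smul]

theorem isDegree_frameField {x : M} (ψ : SmoothBumpFunction (𝓡 n) x) (S : Finset (Fin n)) :
    IsDegree S.card (frameField ψ S) :=
  fun _ => Submodule.smul_mem _ _ (fromChart_mem (extBasis_mem S))

/-- The components of a multivector field in the chart at `x`, cut off by a bump function. -/
def frameCoeff {x : M} (ψ : SmoothBumpFunction (𝓡 n) x) (Y : MVField n M) (S : Finset (Fin n)) :
    C^∞⟮𝓡 n, M; 𝓘(ℝ, ℝ), ℝ⟯ :=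
  ⟨fun p => ψ p • (extBasis n).repr (toChart x p (Y.1 p)) S,
    ψ.contMDiff_smul fun _ hq => (IsSmoothMV.contMDiffAt_repr Y.2 hq S).contMDiffWithinAt⟩

theorem frameCoeff_apply {x : M} (ψ : SmoothBumpFunction (𝓡 n) x) (Y : MVField n M)
    (S : Finset (Fin n)) (p : M) :
    frameCoeff ψ Y S p = ψ p * (extBasis n).repr (toChart x p (Y.1 p)) S := rfl

/-- A bump function as a smooth function. -/
def bumpFun {x : M} (ψ : SmoothBumpFunction (𝓡 n) x) : C^∞⟮𝓡 n, M; 𝓘(ℝ, ℝ), ℝ⟯ :=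
  ⟨ψ, ψ.contMDiff⟩

/-- Two factors ψ are needed: one extends the coefficients by zero to all of M, the other extends
the coordinate fields. -/
theorem bumpFun_mul_eq_sum {x : M} (ψ : SmoothBumpFunction (𝓡 n) x) {j : ℕ} {Y : MVField n M}
    (hY : IsDegree j Y) :
    ofFun (bumpFun ψ) * (ofFun (bumpFun ψ) * Y) =
      ∑ S with S.card = j, ofFun (frameCoeff ψ Y S) * frameField ψ S := by
  refine Subtype.ext (funext fun p => ?_)
  rw [ofFun_mul_apply, ofFun_mul_apply, AddSubmonoidClass.coe_finsetSum, Finset.sum_apply]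
  simp_rw [ofFun_mul_apply, frameField_apply, frameCoeff_apply]
  change ψ p • ψ p • Y.1 p = _
  by_cases hp : p ∈ (chartAt (Model n) x).source
  · conv_lhs => rw [← fromChart_toChart hp (Y.1 p),
      ← (extBasis n).sum_repr (toChart x p (Y.1 p))]
    rw [map_sum, Finset.smul_sum, Finset.smul_sum, Finset.sum_filter]
    refine Finset.sum_congr rfl fun S _ => ?_
    split_ifs with hS
    · rw [map_smul, smul_smul, smul_smul, smul_smul]
      congr 1
      ring
    · rw [extBasis_repr_of_card_ne (toChart_mem (hY p)) hS, zero_smul, map_zero, smul_zero,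
        smul_zero]
  · have h : ψ p = 0 :=
      image_eq_zero_of_notMem_tsupport fun h => hp (ψ.tsupport_subset_chartAt_source h)
    simp [h]

/-- Tensoriality: an additive and `C^∞(M)`-homogeneous map on multivector fields of degree `j`
is determined at `x` by its values on the frame. -/
theorem eq_sum_frameField {x : M} (ψ : SmoothBumpFunction (𝓡 n) x) {j : ℕ}
    (F : MVField n M →+ ℝ)
    (hF : ∀ (f : C^∞⟮𝓡 n, M; 𝓘(ℝ, ℝ), ℝ⟯) (Y : MVField n M), IsDegree j Y →
      F (ofFun f * Y) = f x * F Y)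
    {Y : MVField n M} (hY : IsDegree j Y) :
    F Y = ∑ S with S.card = j,
      (extBasis n).repr (toChart x x (Y.1 x)) S * F (frameField ψ S) := by
  have hψY : IsDegree j (ofFun (bumpFun ψ) * Y) := fun p => by
    rw [ofFun_mul_apply]
    exact Submodule.smul_mem _ _ (hY p)
  have h := congrArg F (bumpFun_mul_eq_sum ψ hY)
  have h1 : bumpFun ψ x = 1 := ψ.eq_one
  -- Since ψ = 1 at x, homogeneity removes both cut-offs on the left.
  rw [hF _ _ hψY, hF _ _ hY, h1, one_mul, one_mul, map_sum] at h
  rw [h]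
  refine Finset.sum_congr rfl fun S hS => ?_
  rw [hF _ _ ((Finset.mem_filter.1 hS).2 ▸ isDegree_frameField ψ S), frameCoeff_apply,
    ψ.eq_one, one_mul]

end Frames

/-! ### Covariant derivatives of forms -/

section Signs

theorem neg_one_pow_eq_ite (k : ℕ) : (-1 : ℝ) ^ k = if Even k then 1 else -1 := by
  split_ifs with h
  · exact h.neg_one_pow
  · exact (Nat.not_even_iff_odd.1 h).neg_one_pow

theorem neg_one_zpow_succ_sub_one_mul (k l : ℕ) :
    (-1 : ℝ) ^ ((((k + 1 : ℕ) : ℤ) - 1) * (l : ℤ)) = (-1 : ℝ) ^ (k * l) := by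
  rw [← zpow_natCast]
  push_cast
  rw [add_sub_cancel_right]

theorem neg_one_zpow_mul_succ_sub_one (k l : ℕ) :
    (-1 : ℝ) ^ ((k : ℤ) * (((l + 1 : ℕ) : ℤ) - 1)) = (-1 : ℝ) ^ (k * l) := by
  rw [mul_comm, neg_one_zpow_succ_sub_one_mul, mul_comm]

theorem neg_one_zpow_succ_sub_one_mul_sub_one (k m : ℕ) :
    (-1 : ℝ) ^ ((((k + 1 : ℕ) : ℤ) - 1) * ((m : ℤ) - 1)) = (-1 : ℝ) ^ (k * m) * (-1 : ℝ) ^ k := by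
  rw [mul_sub, mul_one, zpow_sub₀ (by norm_num), neg_one_zpow_succ_sub_one_mul]
  push_cast
  rw [add_sub_cancel_right, zpow_natCast, div_eq_mul_inv, ← inv_pow]
  norm_num

end Signs

section CovariantDerivative

variable {n : ℕ} {M : Type*} [TopologicalSpace M] [ChartedSpace (Model n) M]
  [IsManifold (𝓡 n) ∞ M]

theorem IsDegree.mul {k l : ℕ} {X Y : MVField n M} (hX : IsDegree k X) (hY : IsDegree l Y) :
    IsDegree (k + l) (X * Y) :=
  fun x => mul_mem_exteriorPower (hX x) (hY x)

theorem mul_ofFun (X : MVField n M) (f : C^∞⟮𝓡 n, M; 𝓘(ℝ, ℝ), ℝ⟯) : X * ofFun f = ofFun f * X :=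
  Subtype.ext (funext fun _ => (Algebra.commutes _ _).symm)

theorem isDegree_ofFun (f : C^∞⟮𝓡 n, M; 𝓘(ℝ, ℝ), ℝ⟯) : IsDegree 0 (ofFun f) := by
  intro x
  rw [ofFun_apply, Algebra.algebraMap_eq_smul_one]
  exact Submodule.smul_mem _ _
    (SetLike.one_mem_graded (A := fun i : ℕ => ⋀[ℝ]^i (TangentSpace (𝓡 n) x)))

theorem IsDegree.exists_eq_ofFun {X : MVField n M} (hX : IsDegree 0 X) :
    ∃ f : C^∞⟮𝓡 n, M; 𝓘(ℝ, ℝ), ℝ⟯, X = ofFun f := by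
  have h : ∀ x, ∃ r : ℝ, algebraMap ℝ _ r = X.1 x := by
    intro x
    have := hX x
    rw [ExteriorAlgebra.exteriorPower, pow_zero, Submodule.mem_one] at this
    exact this
  choose f hf using h
  refine ⟨⟨f, fun x => ?_⟩, Subtype.ext (funext fun x => (hf x).symm)⟩
  -- Smoothness of the function is that of the component along e_∅ = 1.
  refine (X.2 x ∅).congr_of_eventuallyEq (Filter.Eventually.of_forall fun p => ?_)
  have h1 : extBasis n ∅ = 1 := by
    rw [extBasis_apply]
    exact ExteriorAlgebra.ιMulti_zero_apply _
  have h2 : (extBasis n).repr 1 ∅ = 1 := by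
    rw [← h1, Module.Basis.repr_self, Finsupp.single_eq_same]
  change f p = (extBasis n).repr (toChart x p (X.1 p)) ∅
  rw [← hf, AlgHom.commutes, Algebra.algebraMap_eq_smul_one, map_smul, Finsupp.smul_apply, h2]
  simp

theorem extD_smul {w : FormSection n M} {x : M}
    (hw : FormDifferentiableAt (chartForm x w) (extChartAt (𝓡 n) x x)) (c : ℝ)
    (a : ExteriorAlgebra ℝ (TangentSpace (𝓡 n) x)) : extD (c • w) x a = c * extD w x a := by
  change extDerivCoord (fun z => c • chartForm x w z) (extChartAt (𝓡 n) x x) (toChart x x a) =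
    c * extDerivCoord (chartForm x w) (extChartAt (𝓡 n) x x) (toChart x x a)
  have hcw : FormDifferentiableAt (fun z => c • chartForm x w z) (extChartAt (𝓡 n) x x) :=
    fun S => (hw S).const_mul c
  have h : ∀ i, formPartialDeriv i (fun z => c • chartForm x w z) (extChartAt (𝓡 n) x x) =
      c • formPartialDeriv i (chartForm x w) (extChartAt (𝓡 n) x x) := by
    intro i
    refine (extBasis n).ext fun S => ?_
    rw [LinearMap.smul_apply, formPartialDeriv_apply_extBasis, formPartialDeriv_apply_extBasis]
    change fderiv ℝ (fun z => c * chartForm x w z (extBasis n S)) _ _ = _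
    rw [fderiv_const_mul (hw S)]
    rfl
  rw [extDerivCoord_apply hcw, extDerivCoord_apply hw, Finset.mul_sum]
  exact Finset.sum_congr rfl fun i _ => by rw [h]; rfl

namespace HigherConnection

variable (D : HigherConnection n M)

/-- The value at `x` of the covariant derivative along `X` of degree `k + 1` of the `m`-form `w`, as
a function of the multivector field it is applied to. -/
def covValue (k m : ℕ) (X : MVField n M) {w : FormSection n M} (hw : IsSmoothForm w) (x : M) :
    MVField n M →+ ℝ :=
  AddMonoidHom.mk' (fun Y => (-1 : ℝ) ^ (k * m) * extD (interiorProd Y.1 w) x (X.1 x) -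
    w x ((D.cov X Y).1 x)) fun Y Y' => by
      have h := extD_interiorProd_add Y.2 Y'.2 (Y + Y').2 (hw.differentiableAt x) (X.1 x)
      have h' : (D.cov X (Y + Y')).1 x = (D.cov X Y).1 x + (D.cov X Y').1 x := by
        rw [D.right_add]
        rfl
      change _ * extD (interiorProd (Y.1 + Y'.1) w) x (X.1 x) - _ = _
      rw [h, h', map_add]
      ring

variable {D}

theorem covValue_apply {k m : ℕ} {X : MVField n M} {w : FormSection n M} (hw : IsSmoothForm w)
    (x : M) (Y : MVField n M) :
    D.covValue k m X hw x Y = (-1 : ℝ) ^ (k * m) * extD (interiorProd Y.1 w) x (X.1 x) -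
      w x ((D.cov X Y).1 x) := rfl

theorem covValue_eq {k m : ℕ} {X : MVField n M} {w : FormSection n M} (hw : IsSmoothForm w)
    (x : M) (Y : MVField n M) :
    D.covValue k m X hw x Y =
      (-1 : ℝ) ^ ((((k + 1 : ℕ) : ℤ) - 1) * ((m : ℤ) - 1)) *
        lieDeriv (k + 1) X.1 (interiorProd Y.1 w) x 1 - w x ((D.cov X Y).1 x) := by
  rw [lieDeriv_apply_one, neg_one_zpow_succ_sub_one_mul_sub_one, covValue_apply]
  rcases neg_one_pow_eq_or ℝ k with h | h <;> simp [pow_succ, h]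

/-- The two terms in [X, f] carry the signs (-1)^(km+k) and -(-1)^(kj) once Y is moved to the left;
for m = j + k they cancel because k² + k is even. -/
theorem covValue_mul_ofFun {k m j : ℕ} {X Y : MVField n M} {w : FormSection n M}
    (hw : IsSmoothForm w) (x : M) (f : C^∞⟮𝓡 n, M; 𝓘(ℝ, ℝ), ℝ⟯) (hX : IsDegree (k + 1) X)
    (hY : IsDegree j Y) (hj : j + k = m) :
    D.covValue k m X hw x (ofFun f * Y) = f x * D.covValue k m X hw x Y := by
  -- The degree of the bracket is read off from [X, f] = ∇_X f.
  have hs : (schouten X.1 (ofFun f).1) x ∈ ⋀[ℝ]^k (TangentSpace (𝓡 n) x) := by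
    rw [← D.apply_fun _ X f hX]
    exact D.degree (k + 1) 0 k X _ hX (isDegree_ofFun f) rfl x
  have hc : (D.cov X (ofFun f * Y)).1 x =
      schouten X.1 (ofFun f).1 x * Y.1 x + f x • (D.cov X Y).1 x := by
    rw [D.leibniz _ X f Y hX, ← ofFun_mul_apply]
    rfl
  rw [covValue_apply, covValue_apply, hc, extD_interiorProd_ofFun_mul hX f Y
    (hw.differentiableAt x), mul_comm_of_mem hs (hY x), map_add, map_smul, map_smul]
  subst hj
  simp only [neg_one_pow_eq_ite, smul_eq_mul]
  by_cases hk : Even k <;> by_cases hj : Even j <;>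
    simp only [Nat.even_add, Nat.even_mul, hk, hj, if_true, if_false, iff_true, iff_false,
      or_true, or_false, or_self, not_true_eq_false] <;> ring

theorem covValue_ofFun_mul {k m : ℕ} {X Y : MVField n M} {w : FormSection n M}
    (hw : IsSmoothForm w) (x : M) (f : C^∞⟮𝓡 n, M; 𝓘(ℝ, ℝ), ℝ⟯) :
    D.covValue k m (ofFun f * X) hw x Y = f x * D.covValue k m X hw x Y := by
  -- The zero field is the zero function, along which ∇ vanishes.
  have h0 : D.cov 0 Y = 0 := by
    have h1 : (ofFun (0 : C^∞⟮𝓡 n, M; 𝓘(ℝ, ℝ), ℝ⟯) : MVField n M) = 0 :=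
      Subtype.ext (funext fun p => map_zero _)
    rw [← h1]
    exact D.cov_fun 0 Y
  have hc : (D.cov (ofFun f * X) Y).1 x = f x • (D.cov X Y).1 x := by
    have h := D.left_linear f X 0 Y
    rw [add_zero, h0, add_zero] at h
    rw [h, ofFun_mul_apply]
  rw [covValue_apply, covValue_apply, hc, ofFun_mul_apply, map_smul, map_smul, smul_eq_mul,
    smul_eq_mul]
  ring

theorem IsCovDeriv.apply_eq_covValue {k m j : ℕ} {X Y : MVField n M} {w h : FormSection n M}
    (hh : D.IsCovDeriv (k + 1) m X w h) (hw : IsSmoothForm w) (hY : IsDegree j Y)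
    (hj : j + k = m) (x : M) : h x (Y.1 x) = D.covValue k m X hw x Y := by
  rw [covValue_eq]
  exact hh.apply k.succ_pos j Y (by omega) hY x

theorem exists_isCovDeriv [T2Space M] {k m : ℕ} {X : MVField n M} {w : FormSection n M}
    (hw : IsForm m w) (hX : IsDegree k X) : ∃ h, D.IsCovDeriv k m X w h := by
  cases k with
  | zero => exact ⟨0, fun _ _ _ _ _ => rfl, fun h => absurd h (lt_irrefl 0), fun _ => rfl⟩
  | succ k =>
    let ψ : ∀ x : M, SmoothBumpFunction (𝓡 n) x := fun _ => Classical.arbitrary _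
    -- At each x the witness is the linear functional with the prescribed values on the frame of the
    -- chart at x; the degree of X is k + 1, so only |S| = m - k contributes.
    refine ⟨fun x => ∑ S with S.card + k = m, D.covValue k m X hw.smooth x (frameField (ψ x) S) •
      (extBasis n).coord S ∘ₗ (toChart x x).toLinearMap, ?_, ?_, fun h => absurd h k.succ_ne_zero⟩
    · intro x j hj v hv
      rw [LinearMap.sum_apply]
      refine Finset.sum_eq_zero fun S hS => ?_
      have hS : S.card + k = m := (Finset.mem_filter.1 hS).2
      change _ * (extBasis n).repr (toChart x x v) S = 0
      rw [extBasis_repr_of_card_ne (toChart_mem hv) (by omega), mul_zero]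
    · intro _ j Y hj hY x
      have hj : j + k = m := by omega
      rw [← covValue_eq hw.smooth, eq_sum_frameField (ψ x) (D.covValue k m X hw.smooth x)
        (fun f Y hY => covValue_mul_ofFun hw.smooth x f hX hY hj) hY, LinearMap.sum_apply]
      refine Finset.sum_congr (Finset.filter_congr fun S _ => by omega) fun S _ => ?_
      exact mul_comm _ _

theorem isCovDeriv_covForm [T2Space M] {k m : ℕ} {X : MVField n M} {w : FormSection n M}
    (hw : IsForm m w) (hX : IsDegree k X) : D.IsCovDeriv k m X w (D.covForm k m X w) := by
  have h := exists_isCovDeriv (D := D) hw hX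
  rw [covForm, dif_pos h]
  exact h.choose_spec

theorem interiorProd_mul {k j : ℕ} {Y Z : MVField n M} (w : FormSection n M) (hY : IsDegree k Y)
    (hZ : IsDegree j Z) : interiorProd (Y * Z).1 w =
      (-1 : ℝ) ^ (k * j) • interiorProd Y.1 (interiorProd Z.1 w) := by
  funext x
  refine LinearMap.ext fun a => ?_
  change w x (Y.1 x * Z.1 x * a) = _ * w x (Z.1 x * (Y.1 x * a))
  rw [mul_comm_of_mem (hY x) (hZ x), smul_mul_assoc, map_smul, mul_assoc, smul_eq_mul]

/-- The product formula for covariant derivatives along fields of positive degrees. -/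
theorem covValue_mul (hind : D.IsInduced) (htor : D.IsTorsionFree) {k l j m : ℕ}
    {X Y Z : MVField n M} {w : FormSection n M} (hw : IsSmoothForm w) (x : M)
    (hX : IsDegree (k + 1) X) (hY : IsDegree (l + 1) Y) (hZ : IsDegree j Z)
    (hm : j + k + l + 1 = m) :
    D.covValue (k + 1 + l) m (X * Y) hw x Z =
      (-1 : ℝ) ^ (l + 1) * D.covValue k m X hw x (Y * Z) +
        (-1 : ℝ) ^ ((k + 1) * l) * D.covValue l m Y hw x (X * Z) := by
  have hα : FormDifferentiableAt (chartForm x (interiorProd Z.1 w)) (extChartAt (𝓡 n) x x) :=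
    FormDifferentiableAt.chartForm_interiorProd (IsSmoothMV.differentiableAt Z.2 x)
      (hw.differentiableAt x)
  have hXα := FormDifferentiableAt.chartForm_interiorProd (IsSmoothMV.differentiableAt X.2 x) hα
  have hYα := FormDifferentiableAt.chartForm_interiorProd (IsSmoothMV.differentiableAt Y.2 x) hα
  -- Cartan's formula is applied to i_Z w rather than to w.
  have hcartan := extD_mul X.2 Y.2 hα hX hY
  have hlow : (D.cov (X * Y) Z).1 x = X.1 x * (D.cov Y Z).1 x +
      (-1 : ℝ) ^ ((k + 1) * (l + 1)) • (Y.1 x * (D.cov X Z).1 x) := by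
    rw [hind.lower _ _ X Y Z hX hY]
    rfl
  have hupX : (D.cov X (Y * Z)).1 x = (D.cov X Y).1 x * Z.1 x +
      (-1 : ℝ) ^ (k * (l + 1)) • (Y.1 x * (D.cov X Z).1 x) := by
    rw [hind.upper _ _ X Y Z hX hY, neg_one_zpow_succ_sub_one_mul]
    rfl
  have hupY : (D.cov Y (X * Z)).1 x = (D.cov Y X).1 x * Z.1 x +
      (-1 : ℝ) ^ (l * (k + 1)) • (X.1 x * (D.cov Y Z).1 x) := by
    rw [hind.upper _ _ Y X Z hY hX, neg_one_zpow_succ_sub_one_mul]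
    rfl
  -- Torsion-freeness enters only here.
  have hbr : schouten X.1 Y.1 x = (D.cov X Y).1 x - (-1 : ℝ) ^ (k * l) • (D.cov Y X).1 x := by
    have h := congrFun (htor _ _ X Y hX hY) x
    have hs : (-1 : ℝ) ^ ((((k + 1 : ℕ) : ℤ) - 1) * (((l + 1 : ℕ) : ℤ) - 1)) =
        (-1 : ℝ) ^ (k * l) := by
      rw [Nat.cast_succ l, add_sub_cancel_right, neg_one_zpow_succ_sub_one_mul]
    rw [torsion, hs] at h
    exact (sub_eq_zero.1 h).symm
  have hcomm : w x (Z.1 x * schouten X.1 Y.1 x) = (-1 : ℝ) ^ ((k + l + 1) * j) *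
      (w x ((D.cov X Y).1 x * Z.1 x) - (-1 : ℝ) ^ (k * l) * w x ((D.cov Y X).1 x * Z.1 x)) := by
    have hdeg : schouten X.1 Y.1 x ∈ ⋀[ℝ]^(k + l + 1) (TangentSpace (𝓡 n) x) := by
      rw [hbr]
      exact Submodule.sub_mem _ (D.degree _ _ _ X Y hX hY (by omega) x)
        (Submodule.smul_mem _ _ (D.degree _ _ _ Y X hY hX (by omega) x))
    rw [mul_comm_of_mem (hZ x) hdeg, hbr, map_smul, sub_mul, map_sub, smul_mul_assoc, map_smul,
      smul_eq_mul, smul_eq_mul, mul_comm j]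
  change extD _ x (X.1 x * Y.1 x) = _ + _ + _ * w x (Z.1 x * schouten X.1 Y.1 x) at hcartan
  rw [covValue_apply, covValue_apply, covValue_apply, interiorProd_mul w hY hZ,
    interiorProd_mul w hX hZ, extD_smul hYα, extD_smul hXα, hlow, hupX, hupY]
  change _ * extD _ x (X.1 x * Y.1 x) - _ = _
  rw [hcartan, hcomm]
  subst hm
  simp only [map_add, map_smul, smul_eq_mul, neg_one_pow_eq_ite]
  -- After substituting m, all signs depend only on the parities of k, l and j.
  by_cases hk : Even k <;> by_cases hl : Even l <;> by_cases hj : Even j <;>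
    simp only [Nat.even_add, Nat.even_mul, Nat.not_even_one, hk, hl, hj, if_true, if_false,
      iff_true, iff_false,
      or_true, or_false, or_self, not_true_eq_false] <;> ring

theorem dual_ext {x : M} {f g : Module.Dual ℝ (ExteriorAlgebra ℝ (TangentSpace (𝓡 n) x))}
    (h : ∀ S, f (fromChart x x (extBasis n S)) = g (fromChart x x (extBasis n S))) : f = g := by
  have h' : f ∘ₗ (fromChart x x).toLinearMap = g ∘ₗ (fromChart x x).toLinearMap :=
    (extBasis n).ext h
  refine LinearMap.ext fun a => ?_
  rw [← fromChart_toChart (mem_chart_source _ x) a]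
  exact LinearMap.congr_fun h' _

theorem covForm_mul [T2Space M] (hind : D.IsInduced) (htor : D.IsTorsionFree) {k l m : ℕ}
    {X Y : MVField n M} {w : FormSection n M} (hw : IsForm m w) (hX : IsDegree k X)
    (hY : IsDegree l Y) :
    D.covForm (k + l) m (X * Y) w =
      (-1 : ℝ) ^ l • interiorProd Y.1 (D.covForm k m X w) +
        (-1 : ℝ) ^ ((k : ℤ) * ((l : ℤ) - 1)) • interiorProd X.1 (D.covForm l m Y w) := by
  have hXY := isCovDeriv_covForm (D := D) hw (hX.mul hY)
  have hX' := isCovDeriv_covForm (D := D) hw hX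
  have hY' := isCovDeriv_covForm (D := D) hw hY
  refine funext fun x => dual_ext fun S => ?_
  -- Every basis multivector at x is the value of a global field of the same degree, so the defining
  -- conditions can be evaluated.
  obtain ⟨Z, hZ, hZS⟩ : ∃ Z : MVField n M, IsDegree S.card Z ∧
      Z.1 x = fromChart x x (extBasis n S) :=
    ⟨frameField (Classical.arbitrary _) S, isDegree_frameField _ S, frameField_apply_self _ S⟩
  rw [← hZS]
  generalize S.card = j at hZ
  change D.covForm (k + l) m (X * Y) w x (Z.1 x) =
    (-1 : ℝ) ^ l * D.covForm k m X w x ((Y * Z).1 x) +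
      (-1 : ℝ) ^ ((k : ℤ) * ((l : ℤ) - 1)) * D.covForm l m Y w x ((X * Z).1 x)
  -- Outside this degree all three terms vanish by the degree condition.
  by_cases hj : j + (k + l) = m + 1
  · cases k with
    | zero =>
      obtain ⟨f, rfl⟩ := hX.exists_eq_ofFun
      -- The derivative along a function is zero by convention, so only the term with ∇_Y w
      -- survives.
      rw [hX'.zero rfl]
      cases l with
      | zero => rw [hXY.zero rfl, hY'.zero rfl]; simp
      | succ l =>
        rw [Nat.zero_add] at hXY hj ⊢
        rw [hXY.apply_eq_covValue hw.smooth hZ (by omega), covValue_ofFun_mul,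
          ← hY'.apply_eq_covValue hw.smooth hZ (by omega), ofFun_mul_apply, map_smul]
        simp
    | succ k =>
      cases l with
      | zero =>
        obtain ⟨f, rfl⟩ := hY.exists_eq_ofFun
        rw [Nat.add_zero] at hXY hj ⊢
        rw [hY'.zero rfl, hXY.apply_eq_covValue hw.smooth hZ (by omega), mul_ofFun,
          covValue_ofFun_mul, ← hX'.apply_eq_covValue hw.smooth hZ (by omega), ofFun_mul_apply,
          map_smul]
        simp
      | succ l =>
        rw [neg_one_zpow_mul_succ_sub_one,
          hX'.apply_eq_covValue hw.smooth (hY.mul hZ) (by omega),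
          hY'.apply_eq_covValue hw.smooth (hX.mul hZ) (by omega),
          ← covValue_mul hind htor hw.smooth x hX hY hZ (by omega)]
        exact IsCovDeriv.apply_eq_covValue (k := k + 1 + l) hXY hw.smooth hZ (by omega) x
  · rw [hXY.degree x j hj _ (hZ x), hX'.degree x (l + j) (by omega) _ ((hY.mul hZ) x),
      hY'.degree x (k + j) (by omega) _ ((hX.mul hZ) x)]
    simp

end HigherConnection

end CovariantDerivative

end HigherConn

end

theorem mainTheorem8 (n : ℕ) (M : Type*) [TopologicalSpace M] [T2Space M]
    [ChartedSpace (Model n) M] [IsManifold (𝓡 n) ∞ M]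
    (D : HigherConnection n M) (hind : D.IsInduced) (htor : D.IsTorsionFree)
    (m : ℕ) (w : FormSection n M) (hw : IsForm m w) :
    (∀ (k : ℕ) (X : MVField n M), IsDegree k X → D.IsCovDeriv k m X w (D.covForm k m X w)) ∧
    ∀ (k l : ℕ) (X Y : MVField n M), IsDegree k X → IsDegree l Y →
      D.covForm (k + l) m (X * Y) w =
        (-1 : ℝ) ^ l • interiorProd Y.1 (D.covForm k m X w) +
        (-1 : ℝ) ^ ((k : ℤ) * ((l : ℤ) - 1)) • interiorProd X.1 (D.covForm l m Y w) :=
  ⟨fun _ _ hX => HigherConnection.isCovDeriv_covForm hw hX,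
    fun _ _ _ _ hX hY => HigherConnection.covForm_mul hind htor hw hX hY⟩
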